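/- Let $k$ be a field and let $\mathcal C$ be a (skeletally small) $k$-linear additive category which is idempotent complete and Hom-finite, i.e. every $\mathrm{Hom}_{\mathcal C}(X,Y)$ is a finite-dimensional $k$-vector space. Let $G$ be a finite abelian group which splits over $k$, i.e. the group algebra $kG$ is isomorphic as a $k$-algebra to a finite product of copies of $k$. Fix a $k$-linear action of $G$ on $\mathcal C$: $k$-linear autoequivalences $F_g$ $(g\in G)$ of $\mathcal C$ and natural isomorphisms $\varepsilon_{g,h}\colon F_gF_h\to F_{gh}$ with $\varepsilon_{gh,l}\circ\varepsilon_{g,h}F_l=\varepsilon_{g,hl}\circ F_g\varepsilon_{h,l}$ for all $g,h,l\in G$. Let $\mathcal C^G$ be the category of $G$-equivariant objects $(X,\alpha)$, where $\alpha_g\colon X\to F_g(X)$ $(g\in G)$ are isomorphisms with $\alpha_{gh}=(\varepsilon_{g,h})_X\circ F_g(\alpha_h)\circ\alpha_g$; a morphism $(X,\alpha)\to(Y,\beta)$ is a morphism $f\colon X\to Y$ with $\beta_g\circ f=F_g(f)\circ\alpha_g$ for all $g$. The induction functor $\mathrm{Ind}\colon\mathcal C\to\mathcal C^G$ sends $X$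 to $\bigoplus_{h\in G}F_h(X)$, with structure isomorphisms $\bigoplus_hF_h(X)\to F_g(\bigoplus_hF_h(X))$ given diagonally by $(\varepsilon_{g,g^{-1}h})_X^{-1}\colon F_h(X)\to F_gF_{g^{-1}h}(X)$. The character group $\widehat G=\mathrm{Hom}(G,k^*)$ acts strictly on $\mathcal C^G$ by $F_\chi(X,\alpha)=(X,(\chi(g^{-1})\alpha_g)_{g\in G})$, with $F_\chi$ the identity on morphisms (the dual action). For a group $H$ acting $k$-linearly on a $k$-linear additive category $\mathcal D$ by $\{F_h,\varepsilon_{h,h'}\}$: * $\mathrm{Aut}(\mathcal D;H)$ is the group of isomorphism classes of $k$-linear $H$-equivariant autoequivalences $(F,\delta)$, i.e. $k$-linear autoequivalences $F$ of $\mathcal D$ with natural isomorphisms $\delta_h\colon FF_h\to F_hF$ satisfying $\delta_{hh'}\circ F\varepsilon_{h,h'}=\varepsilon_{h,h'}F\circ F_h\delta_{h'}\circ\delta_hF_{h'}$. An isomorphism $(F,\delta)\to(F',\delta')$ is a natural isomorphism $\phi\colon F\to F'$ with $F_h\phi\circ\delta_h=\delta'_h\circ\phi F_h$, and multiplication is induced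 by $(F,\delta)(F',\delta')=(FF',(\delta_hF'\circ F\delta'_h)_h)$. * An object $M$ is basic if it is a finite direct sum of pairwise non-isomorphic indecomposable objects (the zero object is allowed), and $H$-stable if $F_h(M)\simeq M$ for all $h\in H$. $\mathrm{Stab}^H(\mathcal D)$ is the set of isomorphism classes of basic $H$-stable objects, on which $\mathrm{Aut}(\mathcal D;H)$ acts by $[F,\delta].M=F(M)$. * $\mathrm{add}\,M$ is the full subcategory of direct summands of finite direct sums of copies of $M$. Then there is a bijection $$\iota\colon \mathrm{Stab}^G(\mathcal C)\longrightarrow\mathrm{Stab}^{\widehat G}(\mathcal C^G)$$ such that $\mathrm{add}\,\iota(M)=\mathrm{add}\,\mathrm{Ind}(M)$ for every $M\in\mathrm{Stab}^G(\mathcal C)$. Moreover, $\iota$ induces a bijection on orbit sets $$\mathrm{Stab}^G(\mathcal C)/\mathrm{Aut}(\mathcal C;G)\longrightarrow\mathrm{Stab}^{\widehat G}(\mathcal C^G)/\mathrm{Aut}(\mathcal C^G;\widehat G).$$ -/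

import Mathlib

open CategoryTheory CategoryTheory.Limits

universe w w' v u

noncomputable section

namespace Equivariantization

theorem total' {D : Type*} [Category* D] [Preadditive D] {J : Type*} [Fintype J] (f : J → D)
    [HasBiproduct f] : ∑ j, biproduct.π f j ≫ biproduct.ι f j = 𝟙 (⨁ f) := by
  classical
  apply biproduct.hom_ext
  intro i
  simp only [Preadditive.sum_comp, Category.assoc, Category.id_comp]
  rw [Finset.sum_eq_single i]
  · simp
  · intro j _ hj
    rw [biproduct.ι_π_ne _ hj, comp_zero]
  · simp

theorem lift_desc' {D : Type*} [Category* D] [Preadditive D] {J : Type*} [Fintype J] (f : J → D)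
    [HasBiproduct f] {X Y : D} (a : ∀ j, X ⟶ f j) (b : ∀ j, f j ⟶ Y) :
    biproduct.lift a ≫ biproduct.desc b = ∑ j, a j ≫ b j := by
  rw [← Category.id_comp (biproduct.desc b), ← total', Preadditive.sum_comp,
    Preadditive.comp_sum]
  simp

/-- An additive functor commutes with finite direct sums. -/
@[simps]
def mapSumIso {D : Type*} [Category* D] [Preadditive D] [HasFiniteBiproducts D]
    {E : Type*} [Category* E] [Preadditive E] [HasFiniteBiproducts E] (F : D ⥤ E) [F.Additive]
    {J : Type*} [Finite J] (f : J → D) : F.obj (⨁ f) ≅ ⨁ fun j => F.obj (f j) where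
  hom := biproduct.lift fun j => F.map (biproduct.π f j)
  inv := biproduct.desc fun j => F.map (biproduct.ι f j)
  hom_inv_id := by
    cases nonempty_fintype J
    rw [lift_desc']
    simp only [← Functor.map_comp]
    rw [← Functor.map_sum, total', CategoryTheory.Functor.map_id]
  inv_hom_id := by
    classical
    apply biproduct.hom_ext'
    intro i
    apply biproduct.hom_ext
    intro j
    simp only [biproduct.ι_desc_assoc, Category.assoc, biproduct.lift_π, ← Functor.map_comp,
      Category.comp_id, biproduct.ι_π]
    split_ifs with h
    · subst h; simp
    · simp

theorem mapSumIso_inv_π {D : Type*} [Category* D] [Preadditive D] [HasFiniteBiproducts D]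
    {E : Type*} [Category* E] [Preadditive E] [HasFiniteBiproducts E] (F : D ⥤ E) [F.Additive]
    {J : Type*} [Finite J] (f : J → D) (j : J) :
    (mapSumIso F f).inv ≫ F.map (biproduct.π f j) = biproduct.π (fun j => F.obj (f j)) j := by
  rw [Iso.inv_comp_eq]; simp

/-- Morphisms into `F (⨁ f)` are determined by their components. -/
theorem hom_ext_map_sum {D : Type*} [Category* D] [Preadditive D] [HasFiniteBiproducts D]
    {E : Type*} [Category* E] [Preadditive E] [HasFiniteBiproducts E] (F : D ⥤ E) [F.Additive]
    {J : Type*} [Finite J] (f : J → D) {Z : E} {a b : Z ⟶ F.obj (⨁ f)}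
    (h : ∀ j, a ≫ F.map (biproduct.π f j) = b ≫ F.map (biproduct.π f j)) : a = b := by
  rw [← cancel_mono (mapSumIso F f).hom]
  apply biproduct.hom_ext
  intro j
  simpa using h j

/-- A `k`-linear action of a group `G` on a `k`-linear category `C`: `k`-linear autoequivalences
`F g` and natural isomorphisms `ε g h : F_g F_h ≅ F_{gh}` subject to the 2-cocycle condition
`ε_{gh,l} ∘ ε_{g,h} F_l = ε_{g,hl} ∘ F_g ε_{h,l}`.  (The natural isomorphisms are given
by their components; the `eqToHom` identifies `F_{(gh)l} X` with `F_{g(hl)} X`.) -/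
structure LinearAction (k : Type w) [Field k] (G : Type w') [Group G]
    (C : Type u) [Category.{v} C] [Preadditive C] [Linear k C] where
  F : G → C ⥤ C
  additive : ∀ g, (F g).Additive
  linear : ∀ g, (F g).Linear k
  isEquivalence : ∀ g, (F g).IsEquivalence
  ε : ∀ (g h : G) (X : C), (F g).obj ((F h).obj X) ≅ (F (g * h)).obj X
  ε_naturality : ∀ (g h : G) {X Y : C} (f : X ⟶ Y),
    (F g).map ((F h).map f) ≫ (ε g h Y).hom = (ε g h X).hom ≫ (F (g * h)).map f
  cocycle : ∀ (g h l : G) (X : C),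
    (ε g h ((F l).obj X)).hom ≫ (ε (g * h) l X).hom ≫
        eqToHom (congrArg (fun a => (F a).obj X) (mul_assoc g h l)) =
      (F g).map (ε h l X).hom ≫ (ε g (h * l) X).hom

attribute [instance] LinearAction.additive LinearAction.linear LinearAction.isEquivalence

section Equivariant

variable {k : Type w} [Field k] {G : Type w'} [Group G]
  {C : Type u} [Category.{v} C] [Preadditive C] [Linear k C]

/-- A `G`-equivariant object `(X, α)`: isomorphisms `α_g : X ≅ F_g X` such that
`α_{gh} = (ε_{g,h})_X ∘ F_g(α_h) ∘ α_g`. -/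
structure EquivariantObject (A : LinearAction k G C) where
  X : C
  α : ∀ g, X ≅ (A.F g).obj X
  α_mul : ∀ g h, (α (g * h)).hom =
    (α g).hom ≫ (A.F g).map (α h).hom ≫ (A.ε g h X).hom

namespace EquivariantObject

variable {A : LinearAction k G C}

/-- A morphism `(X, α) ⟶ (Y, β)` is a morphism `f : X ⟶ Y` with `β_g ∘ f = F_g(f) ∘ α_g`. -/
@[ext]
structure Hom (P Q : EquivariantObject A) where
  f : P.X ⟶ Q.X
  comm : ∀ g, f ≫ (Q.α g).hom = (P.α g).hom ≫ (A.F g).map f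

instance : Category.{v} (EquivariantObject A) where
  Hom P Q := Hom P Q
  id P := ⟨𝟙 P.X, fun g => by simp⟩
  comp a b := ⟨a.f ≫ b.f, fun g => by
    rw [Category.assoc, b.comm, ← Category.assoc, a.comm, Category.assoc, Functor.map_comp]⟩

@[ext]
theorem hom_ext {P Q : EquivariantObject A} {a b : P ⟶ Q} (h : a.f = b.f) : a = b :=
  Hom.ext h

@[simp]
theorem id_f (P : EquivariantObject A) : Hom.f (𝟙 P) = 𝟙 P.X := rfl

@[simp]
theorem comp_f {P Q R : EquivariantObject A} (a : P ⟶ Q) (b : Q ⟶ R) :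
    (a ≫ b).f = a.f ≫ b.f := rfl

instance (P Q : EquivariantObject A) : Zero (P ⟶ Q) := ⟨⟨0, fun g => by simp⟩⟩

instance (P Q : EquivariantObject A) : Add (P ⟶ Q) :=
  ⟨fun a b => ⟨a.f + b.f, fun g => by
    simp [Functor.map_add, a.comm, b.comm]⟩⟩

instance (P Q : EquivariantObject A) : Neg (P ⟶ Q) :=
  ⟨fun a => ⟨-a.f, fun g => by simp [a.comm]⟩⟩

instance (P Q : EquivariantObject A) : Sub (P ⟶ Q) :=
  ⟨fun a b => ⟨a.f - b.f, fun g => by simp [a.comm, b.comm, Functor.map_sub]⟩⟩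

instance (P Q : EquivariantObject A) : SMul ℕ (P ⟶ Q) :=
  ⟨fun n a => ⟨n • a.f, fun g => by
    simp [a.comm]⟩⟩

instance (P Q : EquivariantObject A) : SMul ℤ (P ⟶ Q) :=
  ⟨fun n a => ⟨n • a.f, fun g => by
    simp [a.comm]⟩⟩

instance (P Q : EquivariantObject A) : SMul k (P ⟶ Q) :=
  ⟨fun r a => ⟨r • a.f, fun g => by simp [a.comm, Functor.map_smul]⟩⟩

theorem f_injective (P Q : EquivariantObject A) :
    Function.Injective (fun a : P ⟶ Q => a.f) := fun _ _ h => hom_ext h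

instance (P Q : EquivariantObject A) : AddCommGroup (P ⟶ Q) :=
  Function.Injective.addCommGroup (fun a : P ⟶ Q => a.f) (f_injective P Q) rfl
    (fun _ _ => rfl) (fun _ => rfl) (fun _ _ => rfl) (fun _ _ => rfl) (fun _ _ => rfl)

@[simp]
theorem add_f {P Q : EquivariantObject A} (a b : P ⟶ Q) : (a + b).f = a.f + b.f := rfl

@[simp]
theorem zero_f (P Q : EquivariantObject A) : Hom.f (0 : P ⟶ Q) = 0 := rfl

@[simp]
theorem smul_f {P Q : EquivariantObject A} (r : k) (a : P ⟶ Q) : (r • a).f = r • a.f := rfl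

/-- The underlying-morphism map, as an additive homomorphism. -/
def fHom (P Q : EquivariantObject A) : (P ⟶ Q) →+ (P.X ⟶ Q.X) where
  toFun a := a.f
  map_zero' := rfl
  map_add' _ _ := rfl

instance : Preadditive (EquivariantObject A) where
  add_comp _ _ _ a b c := by ext; simp
  comp_add _ _ _ a b c := by ext; simp

instance (P Q : EquivariantObject A) : Module k (P ⟶ Q) :=
  Function.Injective.module k (fHom P Q) (f_injective P Q) (fun _ _ => rfl)

instance : Linear k (EquivariantObject A) where
  smul_comp _ _ _ r a b := by ext; simp
  comp_smul _ _ _ a r b := by ext; simp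

/-- An isomorphism of underlying objects which is equivariant is an isomorphism. -/
@[simps]
def mkIso {P Q : EquivariantObject A} (e : P.X ≅ Q.X)
    (h : ∀ g, e.hom ≫ (Q.α g).hom = (P.α g).hom ≫ (A.F g).map e.hom) : P ≅ Q where
  hom := ⟨e.hom, h⟩
  inv := ⟨e.inv, fun g => by
    rw [Iso.inv_comp_eq, ← Category.assoc, h, Category.assoc, ← Functor.map_comp]
    simp⟩
  hom_inv_id := by ext; simp
  inv_hom_id := by ext; simp

section Biproducts

variable [HasFiniteBiproducts C]

/-- The isomorphism `⨁ X_j ≅ F_g (⨁ X_j)` given diagonally by the `(α_j)_g`. -/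
def sumIso {J : Type*} [Finite J] (P : J → EquivariantObject A) (g : G) :
    (⨁ fun j => (P j).X) ≅ (A.F g).obj (⨁ fun j => (P j).X) :=
  biproduct.mapIso (fun j => (P j).α g) ≪≫ (mapSumIso (A.F g) (fun j => (P j).X)).symm

theorem sumIso_π {J : Type*} [Finite J] (P : J → EquivariantObject A) (g : G) (j : J) :
    (sumIso P g).hom ≫ (A.F g).map (biproduct.π (fun j => (P j).X) j) =
      biproduct.π (fun j => (P j).X) j ≫ ((P j).α g).hom := by
  rw [sumIso, Iso.trans_hom, Category.assoc, Iso.symm_hom, mapSumIso_inv_π]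
  simp

/-- The direct sum of a finite family of equivariant objects. -/
abbrev sum {J : Type*} [Finite J] (P : J → EquivariantObject A) : EquivariantObject A where
  X := ⨁ fun j => (P j).X
  α g := sumIso P g
  α_mul g h := by
    apply hom_ext_map_sum
    intro j
    rw [sumIso_π, Category.assoc, Category.assoc, ← A.ε_naturality, (P j).α_mul,
      ← Functor.map_comp_assoc, sumIso_π, Functor.map_comp_assoc, ← Category.assoc,
      ← Category.assoc, ← sumIso_π]
    simp only [Category.assoc]

open scoped Classical in
/-- `sum P` is a biproduct of the family `P`. -/
def sumBicone {J : Type*} [Finite J] (P : J → EquivariantObject A) : Bicone P where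
  pt := sum P
  π j := ⟨biproduct.π (fun j => (P j).X) j, fun g => (sumIso_π P g j).symm⟩
  ι j := ⟨biproduct.ι (fun j => (P j).X) j, fun g => by
    apply hom_ext_map_sum
    intro i
    rw [Category.assoc, Category.assoc, sumIso_π, ← Functor.map_comp]
    by_cases hij : j = i
    · subst hij; simp
    · rw [biproduct.ι_π_ne_assoc _ hij, biproduct.ι_π_ne _ hij]; simp⟩
  ι_π j j' := by
    ext
    by_cases hij : j = j'
    · subst hij
      simp
    · simp [hij]

instance : HasFiniteBiproducts (EquivariantObject A) where
  out n := ⟨fun P => hasBiproduct_of_total (sumBicone P) (by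
    ext
    have hs : ∀ (s : Finset (Fin n)) (a : Fin n → ((sumBicone P).pt ⟶ (sumBicone P).pt)),
        (∑ j ∈ s, a j).f = ∑ j ∈ s, (a j).f := fun s a =>
      map_sum (fHom (sumBicone P).pt (sumBicone P).pt) a s
    rw [hs]
    exact biproduct.total (f := fun j => (P j).X))⟩

end Biproducts

end EquivariantObject

section Induction

variable [HasFiniteBiproducts C] [Finite G]

/-- The diagonal isomorphism `⨁_h F_h X ≅ ⨁_h F_g F_h X` with components
`(ε_{g,h})_X⁻¹ : F_{gh} X ≅ F_g F_h X`. -/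
@[simps]
def shiftIso (A : LinearAction k G C) (X : C) (g : G) :
    (⨁ fun h => (A.F h).obj X) ≅ ⨁ fun h => (A.F g).obj ((A.F h).obj X) where
  hom := biproduct.lift fun h => biproduct.π (fun h => (A.F h).obj X) (g * h) ≫ (A.ε g h X).inv
  inv := biproduct.desc fun h => (A.ε g h X).hom ≫ biproduct.ι (fun h => (A.F h).obj X) (g * h)
  hom_inv_id := by
    cases nonempty_fintype G
    rw [lift_desc']
    simp only [Category.assoc, Iso.inv_hom_id_assoc]
    rw [← total']
    exact Fintype.sum_equiv (Equiv.mulLeft g) _ (fun h => biproduct.π _ h ≫ biproduct.ι _ h)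
      (fun h => rfl)
  inv_hom_id := by
    apply biproduct.hom_ext'
    intro i
    apply biproduct.hom_ext
    intro j
    simp only [biproduct.ι_desc_assoc, Category.assoc, biproduct.lift_π, Category.comp_id]
    by_cases hij : i = j
    · subst hij; simp
    · rw [biproduct.ι_π_ne_assoc _ (fun h => hij (mul_left_cancel h)), biproduct.ι_π_ne _ hij]
      simp

/-- The isomorphism `ε(X)_g : ⨁_h F_h X ≅ F_g (⨁_h F_h X)`, given diagonally by
`(ε_{g,h})_X⁻¹ : F_{gh} X ≅ F_g F_h X`. -/
def indIso (A : LinearAction k G C) (X : C) (g : G) :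
    (⨁ fun h => (A.F h).obj X) ≅ (A.F g).obj (⨁ fun h => (A.F h).obj X) :=
  shiftIso A X g ≪≫ (mapSumIso (A.F g) (fun h => (A.F h).obj X)).symm

theorem indIso_π (A : LinearAction k G C) (X : C) (g h : G) :
    (indIso A X g).hom ≫ (A.F g).map (biproduct.π (fun h => (A.F h).obj X) h) =
      biproduct.π (fun h => (A.F h).obj X) (g * h) ≫ (A.ε g h X).inv := by
  rw [indIso, Iso.trans_hom, Category.assoc, Iso.symm_hom, mapSumIso_inv_π]
  simp

/-- The induced object `Ind X = (⨁_h F_h X, ε(X))`. -/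
abbrev indObj (A : LinearAction k G C) (X : C) : EquivariantObject A where
  X := ⨁ fun h => (A.F h).obj X
  α := indIso A X
  α_mul g h := by
    apply hom_ext_map_sum
    intro l
    have coc := A.cocycle g h l X
    have cast := biproduct.π_comp_eqToHom (fun h => (A.F h).obj X) (mul_assoc g h l)
    rw [indIso_π, Category.assoc, Category.assoc, ← A.ε_naturality, ← Functor.map_comp_assoc,
      indIso_π, Functor.map_comp_assoc, ← Category.assoc, indIso_π, Category.assoc,
      ← cast, Category.assoc]
    congr 1
    rw [← cancel_epi (A.ε (g * h) l X).hom, Iso.hom_inv_id,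
      ← cancel_epi (A.ε g h ((A.F l).obj X)).hom, reassoc_of% coc]
    simp [← Functor.map_comp_assoc]

/-- The induction functor, `Ind X = (⨁_h F_h X, ε(X))` and `Ind θ = ⨁_h F_h θ`. -/
def inductionFunctor (A : LinearAction k G C) : C ⥤ EquivariantObject A where
  obj X := indObj A X
  map {X Y} θ :=
    { f := biproduct.map fun h => (A.F h).map θ
      comm := fun g => by
        apply hom_ext_map_sum
        intro l
        rw [Category.assoc, indIso_π, Category.assoc, ← Functor.map_comp, biproduct.map_π,
          Functor.map_comp, ← Category.assoc, ← Category.assoc, indIso_π, biproduct.map_π,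
          Category.assoc, Category.assoc]
        congr 1
        rw [Iso.comp_inv_eq, Category.assoc, A.ε_naturality, Iso.inv_hom_id_assoc] }
  map_id X := by
    ext
    simp
  map_comp a b := by
    ext
    simp

end Induction

section DualAction

/-- The object `F_χ (X, α) = (X, χ ⊗ α)`, where `(χ ⊗ α)_g = χ(g⁻¹) α_g`. -/
abbrev twistObj {A : LinearAction k G C} (χ : G →* kˣ) (P : EquivariantObject A) :
    EquivariantObject A where
  X := P.X
  α g :=
    { hom := (χ g⁻¹ : k) • (P.α g).hom
      inv := (χ g : k) • (P.α g).inv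
      hom_inv_id := by simp [smul_smul]
      inv_hom_id := by simp [smul_smul] }
  α_mul g h := by
    simp [P.α_mul, smul_smul, mul_comm]

/-- The automorphism `F_χ` of the category of equivariant objects, identity on morphisms. -/
def twist (A : LinearAction k G C) (χ : G →* kˣ) :
    EquivariantObject A ⥤ EquivariantObject A where
  obj P := twistObj χ P
  map a := ⟨a.f, fun g => by simp [a.comm]⟩

theorem eqToHom_f {A : LinearAction k G C} (P : EquivariantObject A) {χ ψ : G →* kˣ}
    (h : χ = ψ) : (eqToHom (congrArg (fun χ => (twist A χ).obj P) h)).f = 𝟙 P.X := by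
  subst h; rfl

instance (A : LinearAction k G C) (χ : G →* kˣ) : (twist A χ).Additive where
  map_add := rfl

instance (A : LinearAction k G C) (χ : G →* kˣ) : (twist A χ).Linear k where
  map_smul _ _ := rfl

instance (A : LinearAction k G C) (χ : G →* kˣ) : (twist A χ).IsEquivalence where
  faithful := ⟨fun h => EquivariantObject.hom_ext (congrArg (fun a => EquivariantObject.Hom.f a) h :)⟩
  full := ⟨fun {P Q} b => ⟨⟨b.f, fun g => by
    let f : P.X ⟶ Q.X := b.f
    have this : f ≫ ((χ g⁻¹ : k) • (Q.α g).hom) =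
      ((χ g⁻¹ : k) • (P.α g).hom) ≫ (A.F g).map f := b.comm g
    rw [Linear.comp_smul, Linear.smul_comp] at this
    exact smul_right_injective _ (χ g⁻¹).ne_zero this⟩, rfl⟩⟩
  essSurj := ⟨fun P => ⟨twistObj χ⁻¹ P, ⟨EquivariantObject.mkIso (Iso.refl P.X) (fun g => by
    simp [twist, smul_smul])⟩⟩⟩

/-- The dual action of the character group `Ĝ = Hom(G, kˣ)` on the category of `G`-equivariant
objects.  It is strict: `F_χ F_ψ = F_{χψ}`, and the structure isomorphisms are given by identity maps. -/
def dualAction (A : LinearAction k G C) :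
    LinearAction k (G →* kˣ) (EquivariantObject A) where
  F χ := twist A χ
  additive _ := inferInstance
  linear _ := inferInstance
  isEquivalence _ := inferInstance
  ε χ ψ P := EquivariantObject.mkIso (Iso.refl P.X) (fun g => by
    simp [twist, smul_smul])
  ε_naturality χ ψ P Q a := by
    ext
    exact (Category.comp_id a.f).trans (Category.id_comp a.f).symm
  cocycle χ ψ ω P := by
    ext
    rw [EquivariantObject.comp_f, EquivariantObject.comp_f, eqToHom_f P (mul_assoc χ ψ ω)]
    change 𝟙 P.X ≫ 𝟙 P.X ≫ 𝟙 P.X = 𝟙 P.X ≫ 𝟙 P.X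
    simp

end DualAction

section Autoequivalences

theorem inv_additive {D : Type*} [Category* D] [Preadditive D] (F : D ⥤ D) [hF : F.Additive]
    [F.IsEquivalence] : F.inv.Additive :=
  haveI : F.asEquivalence.functor.Additive := hF
  F.asEquivalence.inverse_additive

/-- A `k`-linear `G`-equivariant autoequivalence `(F, δ)`, where the natural isomorphisms
`δ_g : F F_g ≅ F_g F` satisfy `δ_{gh} ∘ F ε_{g,h} = ε_{g,h} F ∘ F_g δ_h ∘ δ_g F_h`. -/
structure EquivariantAutoequiv (A : LinearAction k G C) where
  F : C ⥤ C
  additive : F.Additive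
  linear : F.Linear k
  isEquivalence : F.IsEquivalence
  δ : ∀ (g : G) (X : C), F.obj ((A.F g).obj X) ≅ (A.F g).obj (F.obj X)
  δ_naturality : ∀ (g : G) {X Y : C} (f : X ⟶ Y),
    F.map ((A.F g).map f) ≫ (δ g Y).hom = (δ g X).hom ≫ (A.F g).map (F.map f)
  δ_mul : ∀ (g h : G) (X : C),
    F.map (A.ε g h X).hom ≫ (δ (g * h) X).hom =
      (δ g ((A.F h).obj X)).hom ≫ (A.F g).map (δ h X).hom ≫ (A.ε g h (F.obj X)).hom

namespace EquivariantAutoequiv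

attribute [instance] EquivariantAutoequiv.additive EquivariantAutoequiv.linear
  EquivariantAutoequiv.isEquivalence

variable {A : LinearAction k G C}

/-- The identity, with identity structure isomorphisms. -/
def one (A : LinearAction k G C) : EquivariantAutoequiv A where
  F := 𝟭 C
  additive := inferInstance
  linear := inferInstance
  isEquivalence := inferInstance
  δ g X := Iso.refl ((A.F g).obj X)
  δ_naturality g X Y f := by simp
  δ_mul g h X := by simp

/-- The composite `(F, δ)(F', δ') = (FF', (δ_g F' ∘ F δ'_g)_g)`. -/
def mul (P Q : EquivariantAutoequiv A) : EquivariantAutoequiv A where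
  F := Q.F ⋙ P.F
  additive := inferInstance
  linear := inferInstance
  isEquivalence := inferInstance
  δ g X := P.F.mapIso (Q.δ g X) ≪≫ P.δ g (Q.F.obj X)
  δ_naturality g X Y f := by
    have h1 := P.δ_naturality g (Q.F.map f)
    simp only [Functor.comp_map, Iso.trans_hom, Functor.mapIso_hom, Category.assoc]
    rw [← Functor.map_comp_assoc, Q.δ_naturality, Functor.map_comp_assoc, h1]
  δ_mul g h X := by
    have h1 := P.δ_mul g h (Q.F.obj X)
    have h2 := P.δ_naturality g (Q.δ h X).hom
    simp only [Functor.comp_obj, Functor.comp_map, Iso.trans_hom, Functor.mapIso_hom,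
      Functor.map_comp, Category.assoc]
    rw [← Functor.map_comp_assoc, Q.δ_mul]
    simp only [Functor.map_comp, Category.assoc]
    rw [h1, reassoc_of% h2]

/-- Isomorphism of equivariant autoequivalences: a natural isomorphism `φ : F ≅ F'` such that
`F_g φ ∘ δ_g = δ'_g ∘ φ F_g`. -/
def IsIsomorphic (P Q : EquivariantAutoequiv A) : Prop :=
  ∃ φ : P.F ≅ Q.F, ∀ (g : G) (X : C),
    (P.δ g X).hom ≫ (A.F g).map (φ.hom.app X) =
      φ.hom.app ((A.F g).obj X) ≫ (Q.δ g X).hom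

instance setoid (A : LinearAction k G C) : Setoid (EquivariantAutoequiv A) where
  r := IsIsomorphic
  iseqv :=
    { refl := fun P => ⟨Iso.refl _, fun g X => by simp⟩
      symm := by
        rintro P Q ⟨φ, hφ⟩
        refine ⟨φ.symm, fun g X => ?_⟩
        have := hφ g X
        rw [← cancel_epi (φ.hom.app ((A.F g).obj X)), ← reassoc_of% this]
        simp [← Functor.map_comp]
      trans := by
        rintro P Q R ⟨φ, hφ⟩ ⟨ψ, hψ⟩
        refine ⟨φ ≪≫ ψ, fun g X => ?_⟩
        simp [reassoc_of% (hφ g X), hψ g X] }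

theorem mul_congr {P P' Q Q' : EquivariantAutoequiv A} (h : P ≈ P') (h' : Q ≈ Q') :
    mul P Q ≈ mul P' Q' := by
  obtain ⟨φ, hφ⟩ := h
  obtain ⟨ψ, hψ⟩ := h'
  refine ⟨Functor.isoWhiskerRight ψ P.F ≪≫ Functor.isoWhiskerLeft Q'.F φ, fun g X => ?_⟩
  have h1 := hφ g (Q'.F.obj X)
  have h2 := P.δ_naturality g (ψ.hom.app X)
  have h3 := φ.hom.naturality (Q'.δ g X).hom
  simp only [mul, Functor.comp_obj, Iso.trans_hom, Functor.mapIso_hom, NatTrans.comp_app,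
    Functor.isoWhiskerRight_hom, Functor.whiskerRight_app, Functor.isoWhiskerLeft_hom,
    Functor.whiskerLeft_app, Functor.map_comp, Category.assoc]
  rw [← reassoc_of% h2, h1, ← reassoc_of% h3, ← Functor.map_comp_assoc, hψ,
    Functor.map_comp_assoc]

/-- The counit `F F⁻¹ X ≅ X` of a quasi-inverse. -/
def counit (P : EquivariantAutoequiv A) (X : C) : P.F.obj (P.F.inv.obj X) ≅ X :=
  P.F.asEquivalence.counitIso.app X

theorem counit_nat (P : EquivariantAutoequiv A) {X Y : C} (f : X ⟶ Y) :
    P.F.map (P.F.inv.map f) ≫ (P.counit Y).hom = (P.counit X).hom ≫ f :=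
  P.F.asEquivalence.counitIso.hom.naturality f

/-- The structure isomorphisms of the quasi-inverse of an equivariant autoequivalence. -/
def invδ (P : EquivariantAutoequiv A) (g : G) (X : C) :
    P.F.inv.obj ((A.F g).obj X) ≅ (A.F g).obj (P.F.inv.obj X) :=
  P.F.preimageIso (P.counit ((A.F g).obj X) ≪≫
    (A.F g).mapIso (P.counit X).symm ≪≫ (P.δ g (P.F.inv.obj X)).symm)

theorem map_invδ (P : EquivariantAutoequiv A) (g : G) (X : C) :
    P.F.map (P.invδ g X).hom ≫ (P.δ g (P.F.inv.obj X)).hom ≫ (A.F g).map (P.counit X).hom =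
      (P.counit ((A.F g).obj X)).hom := by
  simp [invδ, ← Functor.map_comp]

theorem inv_ext (P : EquivariantAutoequiv A) {g : G} {X Z : C}
    {a b : Z ⟶ (A.F g).obj (P.F.inv.obj X)}
    (h : P.F.map a ≫ (P.δ g (P.F.inv.obj X)).hom ≫ (A.F g).map (P.counit X).hom =
      P.F.map b ≫ (P.δ g (P.F.inv.obj X)).hom ≫ (A.F g).map (P.counit X).hom) : a = b := by
  apply P.F.map_injective
  rwa [cancel_mono] at h

/-- The quasi-inverse of an equivariant autoequivalence. -/
def inv (P : EquivariantAutoequiv A) : EquivariantAutoequiv A where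
  F := P.F.inv
  additive := inv_additive P.F
  linear := ⟨fun {X Y} f r => P.F.map_injective (by
    rw [← cancel_mono (P.counit Y).hom, counit_nat, Functor.map_smul, Linear.smul_comp,
      counit_nat, Linear.comp_smul])⟩
  isEquivalence := inferInstance
  δ := P.invδ
  δ_naturality g X Y f := by
    apply P.inv_ext
    rw [Functor.map_comp_assoc, map_invδ, Functor.map_comp_assoc,
      reassoc_of% P.δ_naturality g (P.F.inv.map f), ← Functor.map_comp, counit_nat, counit_nat,
      Functor.map_comp, reassoc_of% P.map_invδ g X]
  δ_mul g h X := by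
    apply P.inv_ext
    rw [Functor.map_comp_assoc, map_invδ, counit_nat, Functor.map_comp_assoc,
      Functor.map_comp_assoc, reassoc_of% P.δ_mul g h (P.F.inv.obj X), ← A.ε_naturality,
      reassoc_of% P.δ_naturality g (P.invδ h X).hom, ← Functor.map_comp_assoc,
      ← Functor.map_comp_assoc, Category.assoc, map_invδ, reassoc_of% P.map_invδ g]

/-- The inverse unit `F⁻¹ F X ≅ X` of a quasi-inverse. -/
def unitInv (P : EquivariantAutoequiv A) (X : C) : P.F.inv.obj (P.F.obj X) ≅ X :=
  (P.F.asEquivalence.unitIso.app X).symm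

theorem map_unitInv (P : EquivariantAutoequiv A) (X : C) :
    P.F.map (P.unitInv X).hom = (P.counit (P.F.obj X)).hom :=
  (P.F.asEquivalence.counit_app_functor X).symm

theorem inv_mul_equiv (P : EquivariantAutoequiv A) : mul (inv P) P ≈ one A := by
  refine ⟨P.F.asEquivalence.unitIso.symm, fun g X => ?_⟩
  have key : (P.F.inv.map (P.δ g X).hom ≫ (P.invδ g (P.F.obj X)).hom) ≫
      (A.F g).map (P.unitInv X).hom = (P.unitInv ((A.F g).obj X)).hom := by
    apply P.F.map_injective
    rw [← cancel_mono (P.δ g X).hom, Functor.map_comp, Category.assoc, P.δ_naturality,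
      map_unitInv, map_unitInv, ← counit_nat, ← map_invδ, Functor.map_comp, Category.assoc]
  exact key.trans (Category.comp_id _).symm

end EquivariantAutoequiv

/-- The group `Aut(C; G)` of isomorphism classes of `k`-linear `G`-equivariant autoequivalences,
with multiplication induced by composition. -/
def EquivariantAut (A : LinearAction k G C) := Quotient (EquivariantAutoequiv.setoid A)

namespace EquivariantAut

variable (A : LinearAction k G C)

instance : Monoid (EquivariantAut A) where
  mul := Quotient.map₂ EquivariantAutoequiv.mul
    (fun _ _ h _ _ h' => EquivariantAutoequiv.mul_congr h h')
  one := Quotient.mk _ (EquivariantAutoequiv.one A)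
  mul_assoc := by
    rintro ⟨P⟩ ⟨Q⟩ ⟨R⟩
    exact Quotient.sound ⟨Iso.refl _, fun g X => by simp [EquivariantAutoequiv.mul]⟩
  one_mul := by
    rintro ⟨P⟩
    exact Quotient.sound ⟨Iso.refl _, fun g X => by
      simp [EquivariantAutoequiv.mul, EquivariantAutoequiv.one]⟩
  mul_one := by
    rintro ⟨P⟩
    exact Quotient.sound ⟨Iso.refl _, fun g X => by
      simp [EquivariantAutoequiv.mul, EquivariantAutoequiv.one]⟩

theorem exists_left_inv (a : EquivariantAut A) : ∃ b : EquivariantAut A, b * a = 1 := by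
  obtain ⟨P⟩ := a
  exact ⟨Quotient.mk _ P.inv, Quotient.sound P.inv_mul_equiv⟩

instance : Group (EquivariantAut A) where
  inv a := Classical.choose (exists_left_inv A a)
  inv_mul_cancel a := Classical.choose_spec (exists_left_inv A a)

end EquivariantAut

end Autoequivalences

end Equivariant

section Stable

variable {C : Type u} [Category.{v} C] [Preadditive C] [HasFiniteBiproducts C]

attribute [local instance] hasBinaryBiproducts_of_finite_biproducts

/-- `add T`: the direct summands of finite direct sums of copies of `T`. -/
def addClosure (T : C) : ObjectProperty C :=
  fun X => ∃ n : ℕ, Nonempty (Retract X (⨁ fun _ : Fin n => T))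

/-- `M` is basic: it is a finite direct sum of pairwise non-isomorphic indecomposable objects
(that is, in its decomposition each indecomposable summand has multiplicity one). -/
def IsBasic (M : C) : Prop :=
  ∃ (n : ℕ) (N : Fin n → C), Nonempty (M ≅ ⨁ N) ∧ (∀ i, Indecomposable (N i)) ∧
    ∀ i j, Nonempty (N i ≅ N j) → i = j

theorem indecomposable_map (F : C ⥤ C) [F.Additive] [F.IsEquivalence] {N : C}
    (h : Indecomposable N) : Indecomposable (F.obj N) := by
  have hz : ∀ {Y : C}, IsZero (F.inv.obj Y) → IsZero Y := fun {Y} hY =>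
    (F.map_isZero hY).of_iso (F.asEquivalence.counitIso.symm.app Y)
  have : F.inv.Additive := inv_additive F
  refine ⟨fun h0 => h.1 ((F.inv.map_isZero h0).of_iso (F.asEquivalence.unitIso.app N)),
    fun Y Z e => ?_⟩
  have : PreservesBinaryBiproducts F.inv :=
    preservesBinaryBiproducts_of_preservesBiproducts F.inv
  refine (h.2 (F.inv.obj Y) (F.inv.obj Z) (F.asEquivalence.unitIso.app N ≪≫ F.inv.mapIso e ≪≫
    F.inv.mapBiprod Y Z)).imp hz hz

theorem isBasic_map (F : C ⥤ C) [F.Additive] [F.IsEquivalence] {M : C} (h : IsBasic M) :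
    IsBasic (F.obj M) := by
  obtain ⟨n, N, ⟨e⟩, hN, hij⟩ := h
  exact ⟨n, fun i => F.obj (N i), ⟨F.mapIso e ≪≫ mapSumIso F N⟩, fun i => indecomposable_map F (hN i),
    fun i j ⟨f⟩ => hij i j ⟨F.preimageIso f⟩⟩

variable {k : Type w} [Field k] {G : Type w'} [Group G] [Linear k C] (A : LinearAction k G C)

/-- `M` is `G`-stable: `F_g M ≅ M` for all `g`. -/
def IsStable (M : C) : Prop := ∀ g, Nonempty ((A.F g).obj M ≅ M)

/-- The basic `G`-stable objects. -/
def BasicStable := {M : C // IsBasic M ∧ IsStable A M}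

instance BasicStable.setoid : Setoid (BasicStable A) :=
  (isIsomorphicSetoid C).comap Subtype.val

/-- `Stab^G(C)`: the set of isomorphism classes of basic `G`-stable objects. -/
def Stab := Quotient (BasicStable.setoid A)

variable {A}

/-- The image `F(M)` of a basic `G`-stable object under an equivariant autoequivalence. -/
def BasicStable.map (P : EquivariantAutoequiv A) (M : BasicStable A) : BasicStable A :=
  ⟨P.F.obj M.1, isBasic_map P.F M.2.1, fun g => by
    obtain ⟨e⟩ := M.2.2 g
    exact ⟨(P.δ g M.1).symm ≪≫ P.F.mapIso e⟩⟩

/-- The action of `Aut(C; G)` on `Stab^G(C)`, `[F, δ] • [M] = [F(M)]`. -/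
instance : MulAction (EquivariantAut A) (Stab A) where
  smul := Quotient.map₂ BasicStable.map (by
    rintro P Q ⟨φ, -⟩ M N ⟨e⟩
    exact ⟨P.F.mapIso e ≪≫ φ.app N.1⟩)
  one_smul := by
    rintro ⟨M⟩
    exact Quotient.sound ⟨Iso.refl M.1⟩
  mul_smul := by
    rintro ⟨P⟩ ⟨Q⟩ ⟨M⟩
    exact Quotient.sound ⟨Iso.refl _⟩

end Stable

/-- A finite group `G` splits over `k` if `kG` is isomorphic, as a `k`-algebra, to a finite
product of copies of `k`. -/
def SplitsOver (k : Type w) [Field k] (G : Type w') [Group G] : Prop :=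
  ∃ n : ℕ, Nonempty (MonoidAlgebra k G ≃ₐ[k] (Fin n → k))

end Equivariantization

end

noncomputable section

namespace Equivariantization

/-! By Krull–Schmidt a basic object `M` is determined by `add M`, and `ι M` is the basic object with
`add (ι M) = add (Ind M)`. Forgetting the equivariant structure of `Ind M` gives `⨁ F_g M`, whose
additive closure is `add M` when `M` is stable; hence `ι` is injective. Since `G` splits over `k`,
the idempotents of the group algebra of the character group show that `C` is equivalent to the
category of `Ĝ`-equivariant objects of `C^G`, through a functor sending `X` to `Ind X` with the
automorphisms scaling `F_g X` by `χ g`. Under this equivalence induction from `C^G` corresponds to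
forgetting, which makes `ι` surjective. The equivalence intertwines the actions of `G` and of its
bidual, so an equivariant autoequivalence of `C^G` lifts to equivariant objects and then descends
to `C`; conversely those of `C` lift to `C^G`. Hence `ι` identifies orbits.
-/

section FittingLemma

variable {k R : Type*} [Field k] [Ring R] [Algebra k R]

open Polynomial in
theorem exists_commute_isIdempotentElem_mul {a : R} (ha : IsIntegral k a) :
    ∃ (m : ℕ) (b : R), Commute a b ∧ IsIdempotentElem (a * b) ∧ a ^ m * (1 - a * b) = 0 := by
  obtain ⟨q, hq, hXq⟩ :=
    (minpoly k a).exists_eq_pow_rootMultiplicity_mul_and_not_dvd (minpoly.ne_zero ha) 0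
  set m := (minpoly k a).rootMultiplicity 0
  rw [map_zero, sub_zero] at hq hXq
  obtain ⟨r, s, hrs⟩ : IsCoprime ((X : k[X]) ^ (m + 1)) q :=
    (irreducible_X.coprime_iff_not_dvd.2 hXq).pow_left
  have one_sub_mul : 1 - a * (aeval a r * a ^ m) = aeval a (s * q) := by
    rw [eq_sub_of_add_eq' hrs, show r * X ^ (m + 1) = X * (r * X ^ m) by ring, map_sub, map_one,
      map_mul, map_mul, aeval_X, aeval_X_pow]
  have pow_mul_eq_zero : a ^ m * (1 - a * (aeval a r * a ^ m)) = 0 := by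
    rw [one_sub_mul, ← aeval_X_pow (R := k) a, ← map_mul, ← minpoly.dvd_iff, hq]
    exact ⟨s, by ring⟩
  refine ⟨m, aeval a r * a ^ m, ?_, ?_, pow_mul_eq_zero⟩
  · have : Commute a (aeval a r) := by simpa only [aeval_X] using (Commute.all X r).map (aeval a)
    exact this.mul_right (.pow_right rfl m)
  · rw [isIdempotentElem_iff_mul_one_sub_self, mul_assoc a, mul_assoc (aeval a r),
      pow_mul_eq_zero, mul_zero, mul_zero]

theorem isLocalRing_of_isIdempotentElem (k : Type*) [Field k] [Algebra k R] [Module.Finite k R]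
    [Nontrivial R] (h : ∀ e : R, IsIdempotentElem e → e = 0 ∨ e = 1) : IsLocalRing R := by
  refine .of_isUnit_or_isUnit_one_sub_self fun a => ?_
  obtain ⟨m, b, hab, he, hm⟩ :=
    exists_commute_isIdempotentElem_mul (k := k) (Algebra.IsIntegral.isIntegral a)
  rcases h _ he with h0 | h1
  · have : IsNilpotent a := ⟨m, by rwa [h0, sub_zero, mul_one] at hm⟩
    exact .inr this.isUnit_one_sub
  · exact .inl (isUnit_iff_exists.2 ⟨b, h1, hab.eq ▸ h1⟩)

end FittingLemma

section AddClosure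

variable {C : Type u} [Category.{v} C] [Preadditive C]

theorem sum_comp_comp {J : Type*} [Fintype J] {X Y Z : C} {T : J → C} {a : ∀ j, X ⟶ T j}
    {b : ∀ j, T j ⟶ X} (h : ∑ j, a j ≫ b j = 𝟙 X) (f : Y ⟶ X) (g : X ⟶ Z) :
    ∑ j, (f ≫ a j) ≫ b j ≫ g = f ≫ g := by
  calc ∑ j, (f ≫ a j) ≫ b j ≫ g = f ≫ (∑ j, a j ≫ b j) ≫ g := by
        simp only [Preadditive.sum_comp, Preadditive.comp_sum, Category.assoc]
    _ = f ≫ g := by rw [h, Category.id_comp]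

variable [HasFiniteBiproducts C]

theorem addClosure_of_sum {T X : C} {J : Type*} [Fintype J] (a : J → (X ⟶ T)) (b : J → (T ⟶ X))
    (h : ∑ j, a j ≫ b j = 𝟙 X) : addClosure T X := by
  let e := (Fintype.equivFin J).symm
  refine ⟨Fintype.card J, ⟨biproduct.lift fun j => a (e j), biproduct.desc fun j => b (e j), ?_⟩⟩
  rw [lift_desc', ← h]
  exact Fintype.sum_equiv e _ _ fun _ => rfl

theorem addClosure_iff_exists_sum {T X : C} : addClosure T X ↔
    ∃ (n : ℕ) (a : Fin n → (X ⟶ T)) (b : Fin n → (T ⟶ X)), ∑ j, a j ≫ b j = 𝟙 X := by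
  refine ⟨fun ⟨n, ⟨r⟩⟩ => ⟨n, fun j => r.i ≫ biproduct.π (fun _ : Fin n => T) j,
    fun j => biproduct.ι (fun _ : Fin n => T) j ≫ r.r, ?_⟩,
    fun ⟨_, a, b, h⟩ => addClosure_of_sum a b h⟩
  rw [sum_comp_comp (total' _) r.i r.r, r.retract]

theorem addClosure_of_retract {T X : C} (r : Retract X T) : addClosure T X :=
  addClosure_of_sum (J := Unit) (fun _ => r.i) (fun _ => r.r) (by simp)

theorem addClosure_self (T : C) : addClosure T T := addClosure_of_retract (Retract.refl T)

theorem addClosure_of_iso {T X : C} (e : X ≅ T) : addClosure T X :=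
  addClosure_of_retract (Retract.ofIso e)

theorem addClosure_trans {T T' X : C} (h : addClosure T X) (h' : addClosure T' T) :
    addClosure T' X := by
  obtain ⟨n, a, b, hab⟩ := addClosure_iff_exists_sum.1 h
  obtain ⟨m, c, d, hcd⟩ := addClosure_iff_exists_sum.1 h'
  refine addClosure_of_sum (J := Fin n × Fin m) (fun p => a p.1 ≫ c p.2) (fun p => d p.2 ≫ b p.1) ?_
  rw [Fintype.sum_prod_type, ← hab]
  exact Finset.sum_congr rfl fun i _ => sum_comp_comp hcd (a i) (b i)

theorem addClosure_eq {T T' : C} (h : addClosure T' T) (h' : addClosure T T') :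
    addClosure T = addClosure T' :=
  funext fun _ => propext ⟨fun hX => addClosure_trans hX h, fun hX => addClosure_trans hX h'⟩

theorem addClosure_eq_of_iso {T T' : C} (e : T ≅ T') : addClosure T = addClosure T' :=
  addClosure_eq (addClosure_of_iso e) (addClosure_of_iso e.symm)

theorem addClosure_biproduct {T : C} {J : Type*} [Finite J] (f : J → C)
    (h : ∀ j, addClosure T (f j)) : addClosure T (⨁ f) := by
  cases nonempty_fintype J
  choose n a b hab using fun j => addClosure_iff_exists_sum.1 (h j)
  refine addClosure_of_sum (J := Σ j, Fin (n j)) (fun p => biproduct.π f p.1 ≫ a p.1 p.2)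
    (fun p => b p.1 p.2 ≫ biproduct.ι f p.1) ?_
  rw [Fintype.sum_sigma, ← total']
  exact Finset.sum_congr rfl fun j _ => sum_comp_comp (hab j) (biproduct.π f j) (biproduct.ι f j)

theorem addClosure_component {J : Type*} [Finite J] (f : J → C) (j : J) :
    addClosure (⨁ f) (f j) :=
  addClosure_of_retract ⟨biproduct.ι f j, biproduct.π f j, biproduct.ι_π_self f j⟩

theorem addClosure_map {D : Type*} [Category* D] [Preadditive D] [HasFiniteBiproducts D]
    (F : C ⥤ D) [F.Additive] {T X : C} (h : addClosure T X) :
    addClosure (F.obj T) (F.obj X) := by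
  obtain ⟨n, a, b, hab⟩ := addClosure_iff_exists_sum.1 h
  refine addClosure_of_sum (fun j => F.map (a j)) (fun j => F.map (b j)) ?_
  rw [← F.map_id, ← hab, F.map_sum]
  simp only [F.map_comp]

theorem addClosure_map_eq {D : Type*} [Category* D] [Preadditive D] [HasFiniteBiproducts D]
    (F : C ⥤ D) [F.Additive] {T T' : C} (h : addClosure T = addClosure T') :
    addClosure (F.obj T) = addClosure (F.obj T') :=
  addClosure_eq (addClosure_map F (h ▸ addClosure_self T))
    (addClosure_map F (h ▸ addClosure_self T'))

end AddClosure

section KrullSchmidt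

attribute [local instance] hasBinaryBiproducts_of_finite_biproducts

variable {C : Type u} [Category.{v} C] [Preadditive C]

theorem exists_retract_complement [IsIdempotentComplete C] {X Y : C} (r : Retract Y X) :
    ∃ (Z : C) (s : Retract Z X), s.i ≫ r.r = 0 ∧ r.i ≫ s.r = 0 ∧
      r.r ≫ r.i + s.r ≫ s.i = 𝟙 X := by
  obtain ⟨Z, i, p, hip, hpi⟩ := IsIdempotentComplete.idempotents_split X (𝟙 X - r.r ≫ r.i) (by simp)
  have : IsSplitMono i := ⟨⟨p, hip⟩⟩
  have : IsSplitEpi p := ⟨⟨i, hip⟩⟩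
  refine ⟨Z, ⟨i, p, hip⟩, ?_, ?_, by rw [hpi, add_sub_cancel]⟩
  · rw [← cancel_epi p, reassoc_of% hpi]
    simp
  · rw [← cancel_mono i, Category.assoc, hpi]
    simp

theorem exists_retract_of_sum {N : C} [IsLocalRing (End N)] {J : Type*} [Fintype J] {T : J → C}
    (a : ∀ j, N ⟶ T j) (b : ∀ j, T j ⟶ N) (h : ∑ j, a j ≫ b j = 𝟙 N) :
    ∃ j, Nonempty (Retract N (T j)) := by
  have hsum : IsUnit (∑ j, End.of (a j ≫ b j)) := h ▸ isUnit_one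
  obtain ⟨j, -, hj⟩ := IsLocalRing.exists_of_isUnit_sum hsum
  obtain ⟨c, hc⟩ := hj.exists_left_inv
  exact ⟨j, ⟨a j, b j ≫ c, (Category.assoc _ _ _).symm.trans hc⟩⟩

variable [HasFiniteBiproducts C]

theorem isZero_or_isIso_of_retract [IsIdempotentComplete C] {N Y : C} (hN : Indecomposable N)
    (r : Retract Y N) : IsZero Y ∨ IsIso r.i := by
  obtain ⟨Z, s, hsr, hrs, hsum⟩ := exists_retract_complement r
  let e : N ≅ Y ⊞ Z :=
    { hom := biprod.lift r.r s.r
      inv := biprod.desc r.i s.i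
      hom_inv_id := by rw [biprod.lift_desc, hsum]
      inv_hom_id := by ext <;> simp [hsr, hrs] }
  refine (hN.2 Y Z e).imp_right fun hZ => ⟨r.r, r.retract, ?_⟩
  rwa [hZ.eq_of_tgt s.r 0, zero_comp, add_zero] at hsum

theorem nonempty_iso_of_retract [IsIdempotentComplete C] {N N' : C} (h : Indecomposable N)
    (h' : Indecomposable N') (r : Retract N N') : Nonempty (N ≅ N') :=
  have := (isZero_or_isIso_of_retract h' r).resolve_left h.1
  ⟨asIso r.i⟩

theorem eq_zero_or_eq_id_of_indecomposable [IsIdempotentComplete C] {N : C}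
    (hN : Indecomposable N) {e : N ⟶ N} (he : e ≫ e = e) : e = 0 ∨ e = 𝟙 N := by
  obtain ⟨Y, i, p, hip, rfl⟩ := IsIdempotentComplete.idempotents_split N e he
  refine (isZero_or_isIso_of_retract hN ⟨i, p, hip⟩).imp (fun hY => ?_) fun (_ : IsIso i) => ?_
  · rw [hY.eq_of_tgt p 0, zero_comp]
  · rw [← cancel_epi i, reassoc_of% hip, Category.comp_id]

theorem isLocalRing_end [IsIdempotentComplete C] (k : Type*) [Field k] [Linear k C]
    {N : C} [hfin : Module.Finite k (N ⟶ N)] (hN : Indecomposable N) : IsLocalRing (End N) := by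
  have : Nontrivial (End N) := ⟨1, 0, fun h => hN.1 ((IsZero.iff_id_eq_zero N).2 h)⟩
  have : Module.Finite k (End N) := hfin
  exact isLocalRing_of_isIdempotentElem k fun e he => eq_zero_or_eq_id_of_indecomposable hN he

variable {k : Type w} [Field k] [Linear k C]

theorem finrank_end_lt {X Y Z : C} [Module.Finite k (X ⟶ X)] (e : X ≅ Y ⊞ Z) (hZ : ¬IsZero Z) :
    Module.finrank k (Y ⟶ Y) < Module.finrank k (X ⟶ X) := by
  let i : Y ⟶ X := biprod.inl ≫ e.inv
  let r : X ⟶ Y := e.hom ≫ biprod.fst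
  have hir : i ≫ r = 𝟙 Y := by simp [i, r]
  have : IsSplitMono i := ⟨⟨r, hir⟩⟩
  have : IsSplitEpi r := ⟨⟨i, hir⟩⟩
  let φ : (Y ⟶ Y) →ₗ[k] (X ⟶ X) := Linear.leftComp k X r ∘ₗ Linear.rightComp k Y i
  have hφ : Function.Injective φ := fun f g (hfg : r ≫ f ≫ i = r ≫ g ≫ i) =>
    (cancel_mono i).1 ((cancel_epi r).1 hfg)
  rw [← LinearMap.finrank_range_of_inj hφ]
  refine Submodule.finrank_lt fun htop => hZ ((IsZero.iff_id_eq_zero Z).2 ?_)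
  obtain ⟨f, hf : r ≫ f ≫ i = 𝟙 X⟩ : 𝟙 X ∈ LinearMap.range φ := htop ▸ Submodule.mem_top
  calc 𝟙 Z = (biprod.inr ≫ e.inv) ≫ 𝟙 X ≫ e.hom ≫ biprod.snd := by simp
    _ = 0 := by simp [← hf, r]

/-- The direct sum of a family indexed by `J ⊕ J'`, split along the two parts of the index set. -/
def biprodBiproductIso {J J' : Type*} [Finite J] [Finite J'] (f : J ⊕ J' → C) :
    (⨁ fun j => f (.inl j)) ⊞ (⨁ fun j => f (.inr j)) ≅ ⨁ f where
  hom := biprod.desc (biproduct.desc fun j => biproduct.ι f (.inl j))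
    (biproduct.desc fun j => biproduct.ι f (.inr j))
  inv := biproduct.desc <| Sum.rec
    (fun j => biproduct.ι (fun j => f (.inl j)) j ≫ biprod.inl)
    (fun j => biproduct.ι (fun j => f (.inr j)) j ≫ biprod.inr)
  hom_inv_id := by ext1 <;> refine biproduct.hom_ext' _ _ fun j => ?_ <;> simp
  inv_hom_id := biproduct.hom_ext' _ _ <| Sum.rec (fun j => by simp) (fun j => by simp)

theorem exists_iso_biprod_of_not_indecomposable {X : C} (h0 : ¬IsZero X) (hX : ¬Indecomposable X) :
    ∃ Y Z : C, Nonempty (X ≅ Y ⊞ Z) ∧ ¬IsZero Y ∧ ¬IsZero Z := by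
  by_contra! h
  exact hX ⟨h0, fun Y Z e => or_iff_not_imp_left.2 (h Y Z ⟨e⟩)⟩

theorem exists_iso_biproduct_indecomposable (homFinite : ∀ X Y : C, Module.Finite k (X ⟶ Y))
    (X : C) : ∃ (J : Type) (_ : Finite J) (N : J → C), (∀ j, Indecomposable (N j)) ∧
      Nonempty (X ≅ ⨁ N) := by
  induction hn : Module.finrank k (X ⟶ X) using Nat.strong_induction_on generalizing X with
  | _ n ih =>
    subst hn
    by_cases h0 : IsZero X
    · exact ⟨Empty, inferInstance, Empty.elim, nofun,
        ⟨h0.iso ((IsZero.iff_id_eq_zero _).2 (biproduct.hom_ext _ _ nofun))⟩⟩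
    by_cases hX : Indecomposable X
    · exact ⟨Unit, inferInstance, fun _ => X, fun _ => hX, ⟨(biproductUniqueIso fun _ => X).symm⟩⟩
    obtain ⟨Y, Z, ⟨e⟩, hY, hZ⟩ := exists_iso_biprod_of_not_indecomposable h0 hX
    have := homFinite X X
    obtain ⟨J, _, N, hN, ⟨eY⟩⟩ := ih _ (finrank_end_lt (k := k) e hZ) Y rfl
    obtain ⟨J', _, N', hN', ⟨eZ⟩⟩ :=
      ih _ (finrank_end_lt (k := k) (e ≪≫ biprod.braiding Y Z) hY) Z rfl
    exact ⟨J ⊕ J', inferInstance, Sum.elim N N', Sum.rec hN hN',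
      ⟨e ≪≫ biprod.mapIso eY eZ ≪≫ biprodBiproductIso (Sum.elim N N')⟩⟩

theorem exists_isBasic_addClosure_eq (homFinite : ∀ X Y : C, Module.Finite k (X ⟶ Y)) (X : C) :
    ∃ M : C, IsBasic M ∧ addClosure M = addClosure X := by
  obtain ⟨J, _, N, hN, ⟨e⟩⟩ := exists_iso_biproduct_indecomposable homFinite X
  rw [addClosure_eq_of_iso e]
  let S : Setoid J := (isIsomorphicSetoid C).comap N
  let σ := (Finite.equivFin (Quotient S)).symm
  refine ⟨⨁ fun i => N (σ i).out, ⟨_, _, ⟨Iso.refl _⟩, fun i => hN _, fun i j hij =>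
    σ.injective (Quotient.out_equiv_out.1 hij)⟩, addClosure_eq
      (addClosure_biproduct _ fun i => addClosure_component N _)
      (addClosure_biproduct N fun j => ?_)⟩
  obtain ⟨f⟩ : IsIsomorphic (N (Quotient.mk S j).out) (N j) := Quotient.mk_out (s := S) j
  have hout := addClosure_component (fun i => N (σ i).out) (σ.symm (Quotient.mk S j))
  rw [Equiv.apply_symm_apply] at hout
  exact addClosure_trans (addClosure_of_iso f.symm) hout

variable [IsIdempotentComplete C]

theorem exists_iso_of_addClosure_biproduct (homFinite : ∀ X Y : C, Module.Finite k (X ⟶ Y))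
    {X : C} (hX : Indecomposable X) {J : Type*} [Finite J] {N : J → C}
    (hN : ∀ j, Indecomposable (N j)) (h : addClosure (⨁ N) X) : ∃ j, Nonempty (X ≅ N j) := by
  cases nonempty_fintype J
  have := homFinite X X
  have := isLocalRing_end k hX
  obtain ⟨n, a, b, hab⟩ := addClosure_iff_exists_sum.1 h
  obtain ⟨-, ⟨r⟩⟩ := exists_retract_of_sum a b hab
  obtain ⟨j, ⟨s⟩⟩ := exists_retract_of_sum (T := N) (fun j => r.i ≫ biproduct.π N j)
    (fun j => biproduct.ι N j ≫ r.r) ((sum_comp_comp (total' N) r.i r.r).trans r.retract)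
  exact ⟨j, nonempty_iso_of_retract hX (hN j) s⟩

theorem nonempty_iso_of_addClosure_eq (homFinite : ∀ X Y : C, Module.Finite k (X ⟶ Y)) {M M' : C}
    (hM : IsBasic M) (hM' : IsBasic M') (h : addClosure M = addClosure M') :
    Nonempty (M ≅ M') := by
  obtain ⟨n, N, ⟨e⟩, hN, hi⟩ := hM
  obtain ⟨n', N', ⟨e'⟩, hN', hi'⟩ := hM'
  rw [addClosure_eq_of_iso e, addClosure_eq_of_iso e'] at h
  choose s hs using fun i => exists_iso_of_addClosure_biproduct homFinite (hN i) hN'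
    (h ▸ addClosure_component N i)
  choose t ht using fun i => exists_iso_of_addClosure_biproduct homFinite (hN' i) hN
    (h ▸ addClosure_component N' i)
  let σ : Fin n ≃ Fin n' :=
    { toFun := s
      invFun := t
      left_inv := fun i => (hi _ _ ⟨(hs i).some ≪≫ (ht _).some⟩).symm
      right_inv := fun i => (hi' _ _ ⟨(ht i).some ≪≫ (hs _).some⟩).symm }
  exact ⟨e ≪≫ biproduct.whiskerEquiv σ (fun i => (hs i).some.symm) ≪≫ e'.symm⟩

end KrullSchmidt

section Characters

variable {k : Type*} [Field k] {G : Type*} [Group G]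

theorem card_ne_zero [Finite G] (hG : SplitsOver k G) : (Nat.card G : k) ≠ 0 := by
  cases nonempty_fintype G
  obtain ⟨n, ⟨φ⟩⟩ := hG
  have : IsReduced (MonoidAlgebra k G) := isReduced_of_injective φ φ.injective
  intro card_eq_zero
  let s : MonoidAlgebra k G := ∑ g, MonoidAlgebra.of k G g
  have of_mul_s (g : G) : MonoidAlgebra.of k G g * s = s := by
    simp only [s, Finset.mul_sum, ← map_mul]
    exact Fintype.sum_equiv (Equiv.mulLeft g) _ (fun h => MonoidAlgebra.of k G h) fun _ => rfl
  have s_mul_s : s * s = 0 := by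
    calc s * s = ∑ g, MonoidAlgebra.of k G g * s := Finset.sum_mul _ _ _
      _ = (Nat.card G : k) • s := by
        rw [Finset.sum_congr rfl fun g _ => of_mul_s g, Finset.sum_const, Finset.card_univ,
          Nat.card_eq_fintype_card, Nat.cast_smul_eq_nsmul]
      _ = 0 := by rw [card_eq_zero, zero_smul]
  have s_coeff : s.coeff 1 = 1 := by simp [s, MonoidAlgebra.of, Finsupp.finsetSum_apply]
  have s_eq_zero : s = 0 := IsReduced.eq_zero s ⟨2, by rw [sq, s_mul_s]⟩
  exact one_ne_zero (s_coeff.symm.trans (by rw [s_eq_zero]; rfl))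

theorem exists_character_ne (hG : SplitsOver k G) {g h : G} (hgh : g ≠ h) :
    ∃ χ : G →* kˣ, χ g ≠ χ h := by
  obtain ⟨n, ⟨φ⟩⟩ := hG
  by_contra! eq
  refine hgh (MonoidAlgebra.of_injective (R := k) (φ.injective (funext fun i => ?_)))
  let ψ : G →* k := ((Pi.evalMonoidHom (fun _ : Fin n => k) i).comp
    (φ : MonoidAlgebra k G →* (Fin n → k))).comp (MonoidAlgebra.of k G)
  exact congrArg Units.val (eq ψ.toHomUnits)

theorem eq_zero_of_character_smul_eq (hG : SplitsOver k G) {V : Type*} [AddCommGroup V]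
    [Module k V] {g h : G} (hgh : g ≠ h) {v : V}
    (hv : ∀ χ : G →* kˣ, (χ g : k) • v = (χ h : k) • v) : v = 0 := by
  obtain ⟨χ, hχ⟩ := exists_character_ne hG hgh
  by_contra hv0
  exact hχ (Units.ext (smul_left_injective k hv0 (hv χ)))

section CharacterIdempotent

variable {R : Type*} [Ring R] [Algebra k R] [Fintype (G →* kˣ)]

/-- The idempotent `e_h = |G|⁻¹ ∑_χ χ(h⁻¹) ρ(χ)` which projects a representation `ρ` of the
character group onto its isotypic component for the character `χ ↦ χ(h)`. -/
def characterIdempotent (ρ : (G →* kˣ) →* R) (h : G) : R :=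
  (Nat.card G : k)⁻¹ • ∑ χ : G →* kˣ, (χ h⁻¹ : k) • ρ χ

theorem mul_characterIdempotent (ρ : (G →* kˣ) →* R) (χ : G →* kˣ) (h : G) :
    ρ χ * characterIdempotent ρ h = (χ h : k) • characterIdempotent ρ h := by
  rw [characterIdempotent, mul_smul_comm, smul_comm (χ h : k), Finset.mul_sum,
    Finset.smul_sum (r := (χ h : k))]
  refine congrArg (fun x : R => (Nat.card G : k)⁻¹ • x) ?_
  exact Fintype.sum_equiv (Equiv.mulLeft χ) _ _ fun ψ => by simp [smul_smul]

theorem commute_characterIdempotent (ρ : (G →* kˣ) →* R) (χ : G →* kˣ) (h : G) :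
    Commute (ρ χ) (characterIdempotent ρ h) :=
  .smul_right (.sum_right _ _ _ fun ψ _ => .smul_right ((Commute.all χ ψ).map ρ) _) _

theorem completeOrthogonalIdempotents_character [Fintype G] (hG : SplitsOver k G)
    (ρ : (G →* kˣ) →* R) : CompleteOrthogonalIdempotents (characterIdempotent ρ) := by
  refine CompleteOrthogonalIdempotents.iff_ortho_complete.2 ⟨fun h l hhl => ?_, ?_⟩
  · refine eq_zero_of_character_smul_eq hG hhl fun χ => ?_
    rw [← smul_mul_assoc, ← mul_characterIdempotent, (commute_characterIdempotent ρ χ h).eq,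
      mul_assoc, mul_characterIdempotent, mul_smul_comm]
  · have sum_inv_eq_zero (χ : G →* kˣ) (hχ : χ ≠ 1) : ∑ h, (χ h⁻¹ : k) = 0 := by
      refine (Equiv.sum_comp (Equiv.inv G) fun h => (χ h : k)).trans
        (sum_hom_units_eq_zero ((Units.coeHom k).comp χ) fun h => hχ ?_)
      exact MonoidHom.ext fun g => Units.ext (DFunLike.congr_fun h g)
    calc ∑ h, characterIdempotent ρ h
        = (Nat.card G : k)⁻¹ • ∑ χ : G →* kˣ, (∑ h, (χ h⁻¹ : k)) • ρ χ := by
          simp only [characterIdempotent, ← Finset.smul_sum, Finset.sum_smul]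
          rw [Finset.sum_comm]
      _ = (Nat.card G : k)⁻¹ • (Nat.card G : k) • 1 := by
          rw [Finset.sum_eq_single 1 (fun χ _ hχ => by rw [sum_inv_eq_zero χ hχ, zero_smul])
            fun h => absurd (Finset.mem_univ _) h]
          simp
      _ = 1 := inv_smul_smul₀ (card_ne_zero hG) 1

end CharacterIdempotent

end Characters

section EquivariantCategory

variable {k : Type*} [Field k] {G : Type*} [Group G]
  {C : Type*} [Category* C] [Preadditive C] [Linear k C]

theorem homFinite_equivariant (homFinite : ∀ X Y : C, Module.Finite k (X ⟶ Y))
    (A : LinearAction k G C) (P Q : EquivariantObject A) : Module.Finite k (P ⟶ Q) := by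
  have := homFinite P.X Q.X
  let forgetHom : (P ⟶ Q) →ₗ[k] (P.X ⟶ Q.X) :=
    { EquivariantObject.fHom P Q with map_smul' := fun _ _ => rfl }
  exact Module.Finite.of_injective forgetHom (EquivariantObject.f_injective P Q)

/-- The equivariant structure on the image `Y` of an equivariant idempotent `p`. -/
abbrev EquivariantObject.image {A : LinearAction k G C} {P : EquivariantObject A} {p : P ⟶ P}
    {Y : C} (s : Retract Y P.X) (hs : s.r ≫ s.i = p.f) : EquivariantObject A where
  X := Y
  α g :=
    { hom := s.i ≫ (P.α g).hom ≫ (A.F g).map s.r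
      inv := (A.F g).map s.i ≫ (P.α g).inv ≫ s.r
      hom_inv_id := by
        simp only [Category.assoc]
        rw [← Functor.map_comp_assoc, hs, ← reassoc_of% p.comm, ← hs]
        simp
      inv_hom_id := by
        simp only [Category.assoc]
        rw [reassoc_of% hs, reassoc_of% p.comm, ← hs]
        simp [← Functor.map_comp] }
  α_mul g h := by
    simp only [Functor.map_comp, Category.assoc]
    rw [A.ε_naturality, ← Functor.map_comp_assoc, hs, ← reassoc_of% (p.comm g), ← hs, P.α_mul]
    simp only [Category.assoc, s.retract_assoc]

instance idempotentComplete_equivariant [IsIdempotentComplete C] (A : LinearAction k G C) :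
    IsIdempotentComplete (EquivariantObject A) where
  idempotents_split P p hp := by
    obtain ⟨Y, i, r, hir, hri⟩ := IsIdempotentComplete.idempotents_split P.X p.f
      (congrArg EquivariantObject.Hom.f hp)
    refine ⟨.image ⟨i, r, hir⟩ hri, ⟨i, fun g => ?_⟩, ⟨r, fun g => ?_⟩, ?_, ?_⟩
    · simp only [Category.assoc, ← Functor.map_comp]
      rw [hri, ← p.comm, ← hri]
      simp [reassoc_of% hir]
    · rw [reassoc_of% hri, reassoc_of% (p.comm g), ← Functor.map_comp, ← hri]
      simp [hir]
    · exact EquivariantObject.hom_ext hir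
    · exact EquivariantObject.hom_ext hri

end EquivariantCategory

section Biproducts

variable {C : Type*} [Category* C] [Preadditive C] [HasFiniteBiproducts C] {J : Type*} [Finite J]

theorem eq_biproduct_map {f g : J → C} {a : (⨁ f) ⟶ ⨁ g}
    (ha : ∀ i j, i ≠ j → biproduct.ι f i ≫ a ≫ biproduct.π g j = 0) :
    a = biproduct.map fun j => biproduct.ι f j ≫ a ≫ biproduct.π g j := by
  apply biproduct.hom_ext'
  intro i
  apply biproduct.hom_ext
  intro j
  simp only [biproduct.ι_map, Category.assoc]
  obtain rfl | hij := eq_or_ne i j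
  · simp
  · rw [ha i j hij, biproduct.ι_π_ne _ hij, comp_zero, comp_zero, comp_zero]

/-- The decomposition of an object along retracts whose idempotents are complete and orthogonal. -/
def biproductIsoOfRetracts [Fintype J] {X : C} {T : J → C} (s : ∀ j, Retract (T j) X)
    {e : J → End X} (he : CompleteOrthogonalIdempotents e) (hs : ∀ j, (s j).r ≫ (s j).i = e j) :
    X ≅ ⨁ T where
  hom := biproduct.lift fun j => (s j).r
  inv := biproduct.desc fun j => (s j).i
  hom_inv_id := by
    simp only [lift_desc', hs]
    exact he.complete
  inv_hom_id := by
    apply biproduct.hom_ext'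
    intro i
    apply biproduct.hom_ext
    intro j
    simp only [biproduct.ι_desc_assoc, Category.assoc, biproduct.lift_π, Category.comp_id]
    obtain rfl | hij := eq_or_ne i j
    · simp
    · have ortho : e i ≫ e j = 0 := he.ortho hij.symm
      rw [biproduct.ι_π_ne _ hij]
      simpa [← hs] using congrArg (fun x => (s i).i ≫ x ≫ (s j).r) ortho

end Biproducts

section Comparison

variable {k : Type*} [Field k] {G : Type*} [Group G]
  {C : Type*} [Category* C] [Preadditive C] [Linear k C]

/-- The strict action of a group `K` on equivariant objects by twisting along a homomorphism from
`K` to the character group. -/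
def twistAction {K : Type*} [Group K] (A : LinearAction k G C) (φ : K →* G →* kˣ) :
    LinearAction k K (EquivariantObject A) where
  F x := twist A (φ x)
  additive _ := inferInstance
  linear _ := inferInstance
  isEquivalence _ := inferInstance
  ε x y P := EquivariantObject.mkIso (Iso.refl P.X) fun g => by simp [twist, smul_smul]
  ε_naturality x y P Q a := by
    ext
    exact (Category.comp_id a.f).trans (Category.id_comp a.f).symm
  cocycle x y z P := by
    ext
    have assoc_f : (eqToHom (congrArg (fun a => (twist A (φ a)).obj P) (mul_assoc x y z))).f =
        𝟙 P.X := eqToHom_f P (congrArg φ (mul_assoc x y z))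
    rw [EquivariantObject.comp_f, EquivariantObject.comp_f, assoc_f]
    change 𝟙 P.X ≫ 𝟙 P.X ≫ 𝟙 P.X = 𝟙 P.X ≫ 𝟙 P.X
    rw [Category.id_comp]

/-- The action of `G` on the bi-equivariant objects through evaluation of characters. -/
abbrev bidualAction (A : LinearAction k G C) :
    LinearAction k G (EquivariantObject (dualAction A)) :=
  twistAction (dualAction A) MonoidHom.eval

theorem exists_eq_map_of_comp_ε_inv {A : LinearAction k G C} {X Y : C}
    {a : ∀ h, (A.F h).obj X ⟶ (A.F h).obj Y}
    (ha : ∀ g h, a (g * h) ≫ (A.ε g h Y).inv = (A.ε g h X).inv ≫ (A.F g).map (a h)) :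
    ∃ θ : X ⟶ Y, a = fun h => (A.F h).map θ := by
  obtain ⟨θ, hθ⟩ := (A.F 1).map_surjective (a 1)
  have a_mul_one (g : G) : a (g * 1) = (A.F (g * 1)).map θ := by
    have := ha g 1
    rwa [Iso.comp_inv_eq, Category.assoc, ← hθ, A.ε_naturality, Iso.inv_hom_id_assoc] at this
  exact ⟨θ, funext fun g => mul_one g ▸ a_mul_one g⟩

variable [HasFiniteBiproducts C] [Finite G]

/-- The endomorphism of `⨁_h F_h X` given by the scalar `χ(h)` on `F_h X`. -/
def characterScale (A : LinearAction k G C) (X : C) (χ : G →* kˣ) :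
    (⨁ fun h => (A.F h).obj X) ⟶ ⨁ fun h => (A.F h).obj X :=
  biproduct.map fun h => (χ h : k) • 𝟙 ((A.F h).obj X)

theorem characterScale_π (A : LinearAction k G C) (X : C) (χ : G →* kˣ) (h : G) :
    characterScale A X χ ≫ biproduct.π (fun h => (A.F h).obj X) h =
      (χ h : k) • biproduct.π (fun h => (A.F h).obj X) h := by
  simp [characterScale]

theorem ι_characterScale (A : LinearAction k G C) (X : C) (χ : G →* kˣ) (h : G) :
    biproduct.ι (fun h => (A.F h).obj X) h ≫ characterScale A X χ =
      (χ h : k) • biproduct.ι (fun h => (A.F h).obj X) h := by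
  simp [characterScale]

theorem characterScale_one (A : LinearAction k G C) (X : C) : characterScale A X 1 = 𝟙 _ := by
  apply biproduct.hom_ext
  intro h
  simp [characterScale]

theorem characterScale_mul (A : LinearAction k G C) (X : C) (χ ψ : G →* kˣ) :
    characterScale A X (χ * ψ) = characterScale A X χ ≫ characterScale A X ψ := by
  apply biproduct.hom_ext
  intro h
  simp [characterScale, smul_smul, mul_comm]

/-- The automorphism of `⨁_h F_h X` given by the scalar `χ(h)` on `F_h X`. -/
@[simps]
def characterScaleIso (A : LinearAction k G C) (X : C) (χ : G →* kˣ) :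
    (⨁ fun h => (A.F h).obj X) ≅ ⨁ fun h => (A.F h).obj X where
  hom := characterScale A X χ
  inv := characterScale A X χ⁻¹
  hom_inv_id := by rw [← characterScale_mul, mul_inv_cancel χ, characterScale_one]
  inv_hom_id := by rw [← characterScale_mul, inv_mul_cancel χ, characterScale_one]

/-- The isomorphism `Ind X ≅ F_χ (Ind X)` given by the scalar `χ(h)` on `F_h X`. -/
def indTwistIso (A : LinearAction k G C) (X : C) (χ : G →* kˣ) :
    indObj A X ≅ (twist A χ).obj (indObj A X) :=
  EquivariantObject.mkIso (P := indObj A X) (Q := (twist A χ).obj (indObj A X))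
    (characterScaleIso A X χ)
    fun g => by
      apply hom_ext_map_sum
      intro l
      simp only [twist, characterScaleIso_hom, Category.assoc, Linear.comp_smul, Linear.smul_comp,
        indIso_π, ← Functor.map_comp, characterScale_π, Functor.map_smul]
      rw [← Category.assoc, characterScale_π]
      simp [smul_smul]

/-- The comparison functor from `C` to the bi-equivariant objects: `X` goes to `Ind X`, where `χ`
acts by the scalar `χ(h)` on `F_h X`. -/
def comparison (A : LinearAction k G C) : C ⥤ EquivariantObject (dualAction A) where
  obj X :=
    { X := indObj A X
      α := indTwistIso A X
      α_mul χ ψ := by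
        ext1
        refine (characterScale_mul A X χ ψ).trans ?_
        exact congrArg (characterScale A X χ ≫ ·) (Category.comp_id _).symm }
  map {X Y} θ :=
    { f := (inductionFunctor A).map θ
      comm χ := by
        ext1
        apply biproduct.hom_ext
        intro h
        change ((biproduct.map fun h => (A.F h).map θ) ≫ characterScale A Y χ) ≫ _ =
          (characterScale A X χ ≫ (biproduct.map fun h => (A.F h).map θ)) ≫ _
        simp [characterScale] }
  map_id X := by
    ext1
    exact (inductionFunctor A).map_id X
  map_comp a b := by
    ext1
    exact (inductionFunctor A).map_comp a b

instance (A : LinearAction k G C) : (inductionFunctor A).Additive where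
  map_add {X Y a b} := by
    ext1
    apply biproduct.hom_ext
    intro j
    change (biproduct.map fun h => (A.F h).map (a + b)) ≫ _ =
      ((biproduct.map fun h => (A.F h).map a) + biproduct.map fun h => (A.F h).map b) ≫ _
    simp

instance (A : LinearAction k G C) : (inductionFunctor A).Linear k where
  map_smul {X Y} a r := by
    ext1
    apply biproduct.hom_ext
    intro j
    change (biproduct.map fun h => (A.F h).map (r • a)) ≫ _ =
      (r • biproduct.map fun h => (A.F h).map a) ≫ _
    simp

instance (A : LinearAction k G C) : (inductionFunctor A).Faithful where
  map_injective {X Y a b} h := by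
    have h1 : (biproduct.map fun h => (A.F h).map a) = (biproduct.map fun h => (A.F h).map b) :=
      congrArg (fun x => x.f) h
    refine (A.F 1).map_injective ?_
    simpa using congrArg (fun x => biproduct.ι _ 1 ≫ x ≫ biproduct.π _ 1) h1

instance (A : LinearAction k G C) : (comparison A).Additive where
  map_add := EquivariantObject.hom_ext (inductionFunctor A).map_add

instance (A : LinearAction k G C) : (comparison A).Linear k where
  map_smul a r := EquivariantObject.hom_ext ((inductionFunctor A).map_smul r a)

instance (A : LinearAction k G C) : (comparison A).Faithful where
  map_injective h :=
    (inductionFunctor A).map_injective (congrArg (fun x => EquivariantObject.Hom.f x) h)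

theorem eq_biproduct_map_of_comp_characterScale (hG : SplitsOver k G) {A : LinearAction k G C}
    {X Y : C} {a : (⨁ fun h => (A.F h).obj X) ⟶ ⨁ fun h => (A.F h).obj Y}
    (ha : ∀ χ, a ≫ characterScale A Y χ = characterScale A X χ ≫ a) :
    a = biproduct.map fun h =>
      biproduct.ι (fun h => (A.F h).obj X) h ≫ a ≫ biproduct.π (fun h => (A.F h).obj Y) h := by
  refine eq_biproduct_map fun h l hhl => eq_zero_of_character_smul_eq hG hhl fun χ => ?_
  rw [← Linear.smul_comp, ← ι_characterScale, Category.assoc, ← reassoc_of% ha, characterScale_π,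
    Linear.comp_smul, Linear.comp_smul]

theorem exists_eq_biproduct_map_of_comp_indIso {A : LinearAction k G C} {X Y : C}
    {a : ∀ h, (A.F h).obj X ⟶ (A.F h).obj Y}
    (ha : ∀ g, biproduct.map a ≫ (indIso A Y g).hom =
      (indIso A X g).hom ≫ (A.F g).map (biproduct.map a)) :
    ∃ θ : X ⟶ Y, biproduct.map a = biproduct.map fun h => (A.F h).map θ := by
  obtain ⟨θ, rfl⟩ : ∃ θ : X ⟶ Y, a = fun h => (A.F h).map θ := by
    refine exists_eq_map_of_comp_ε_inv fun g h => ?_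
    have := congrArg (fun x => biproduct.ι (fun h => (A.F h).obj X) (g * h) ≫ x ≫
      (A.F g).map (biproduct.π (fun h => (A.F h).obj Y) h)) (ha g)
    simp only [Category.assoc, indIso_π, ← Functor.map_comp, biproduct.map_π] at this
    rw [Functor.map_comp, reassoc_of% indIso_π A X g h] at this
    simpa using this
  exact ⟨θ, rfl⟩

theorem comparison_full (hG : SplitsOver k G) (A : LinearAction k G C) :
    (comparison A).Full where
  map_surjective {X Y} b := by
    have b_eq := eq_biproduct_map_of_comp_characterScale hG (a := b.f.f)
      fun χ => congrArg (fun x => x.f) (b.comm χ)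
    have b_comm (g : G) := b.f.comm g
    rw [b_eq] at b_comm
    obtain ⟨θ, hθ⟩ := exists_eq_biproduct_map_of_comp_indIso b_comm
    exact ⟨θ, EquivariantObject.hom_ext (EquivariantObject.hom_ext (b_eq.trans hθ).symm)⟩

end Comparison

section Duality

variable {k : Type*} [Field k] {G : Type*} [Group G]
  {C : Type*} [Category* C] [Preadditive C] [Linear k C] {A : LinearAction k G C}

/-- The automorphism of the object underlying `Q` which gives the isomorphism `Q ≅ F_χ Q`. -/
def characterEnd (Q : EquivariantObject (dualAction A)) (χ : G →* kˣ) : Q.X.X ⟶ Q.X.X :=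
  (Q.α χ).hom.f

theorem characterEnd_mul (Q : EquivariantObject (dualAction A)) (χ ψ : G →* kˣ) :
    characterEnd Q (χ * ψ) = characterEnd Q χ ≫ characterEnd Q ψ :=
  (congrArg EquivariantObject.Hom.f (Q.α_mul χ ψ)).trans
    (congrArg (characterEnd Q χ ≫ ·) (Category.comp_id (characterEnd Q ψ)))

theorem characterEnd_one (Q : EquivariantObject (dualAction A)) : characterEnd Q 1 = 𝟙 Q.X.X := by
  let b : Q.X.X ⟶ Q.X.X := (Q.α 1).inv.f
  have inv : characterEnd Q 1 ≫ b = 𝟙 Q.X.X :=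
    congrArg EquivariantObject.Hom.f (Q.α 1).hom_inv_id
  have idem : characterEnd Q 1 = characterEnd Q 1 ≫ characterEnd Q 1 := by
    rw [← characterEnd_mul, mul_one (1 : G →* kˣ)]
  calc characterEnd Q 1 = characterEnd Q 1 ≫ characterEnd Q 1 ≫ b := by rw [inv, Category.comp_id]
    _ = 𝟙 Q.X.X := by rw [← Category.assoc, ← idem, inv]

theorem α_map_characterEnd (Q : EquivariantObject (dualAction A)) (χ : G →* kˣ) (g : G) :
    (Q.X.α g).hom ≫ (A.F g).map (characterEnd Q χ) =
      (χ g⁻¹ : k) • characterEnd Q χ ≫ (Q.X.α g).hom :=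
  ((Q.α χ).hom.comm g).symm.trans (Linear.comp_smul _ _ _ _ _ _)

/-- The representation of the character group carried by a bi-equivariant object. -/
def characterHom (Q : EquivariantObject (dualAction A)) : (G →* kˣ) →* End Q.X.X where
  toFun := characterEnd Q
  map_one' := characterEnd_one Q
  map_mul' χ ψ := (congrArg (characterEnd Q) (mul_comm χ ψ)).trans (characterEnd_mul Q ψ χ)

/-- The projection of a bi-equivariant object onto the summand where `χ` acts by `χ(g)`. -/
def characterProjection [Fintype (G →* kˣ)] (Q : EquivariantObject (dualAction A)) (g : G) :
    Q.X.X ⟶ Q.X.X :=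
  characterIdempotent (R := End Q.X.X) (characterHom Q) g

theorem characterProjection_eq [Fintype (G →* kˣ)] (Q : EquivariantObject (dualAction A)) (g : G) :
    characterProjection Q g = (Nat.card G : k)⁻¹ • ∑ χ : G →* kˣ, (χ g⁻¹ : k) • characterEnd Q χ :=
  rfl

theorem characterEnd_characterProjection [Fintype (G →* kˣ)] (Q : EquivariantObject (dualAction A))
    (χ : G →* kˣ) (g : G) :
    characterEnd Q χ ≫ characterProjection Q g = (χ g : k) • characterProjection Q g :=
  (commute_characterIdempotent (characterHom Q) χ g).eq.symm.trans
    (mul_characterIdempotent (characterHom Q) χ g)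

theorem α_map_characterProjection [Fintype (G →* kˣ)] (Q : EquivariantObject (dualAction A))
    (g : G) : (Q.X.α g).hom ≫ (A.F g).map (characterProjection Q 1) =
      characterProjection Q g ≫ (Q.X.α g).hom := by
  simp only [characterProjection_eq, Functor.map_smul, Functor.map_sum, Linear.comp_smul,
    Linear.smul_comp, Preadditive.comp_sum, Preadditive.sum_comp, α_map_characterEnd]
  simp

/-- A retract `Y` of the object underlying `P` yields retracts `F_g Y ⊆ F_g P ≅ P`. -/
def shiftRetract (P : EquivariantObject A) {Y : C} (s : Retract Y P.X) (g : G) :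
    Retract ((A.F g).obj Y) P.X :=
  (s.map (A.F g)).trans (P.α g).symm.retract

theorem shiftRetract_r_comp_i (P : EquivariantObject A) {Y : C} (s : Retract Y P.X) (g : G) :
    (shiftRetract P s g).r ≫ (shiftRetract P s g).i =
      (P.α g).hom ≫ (A.F g).map (s.r ≫ s.i) ≫ (P.α g).inv := by
  simp [shiftRetract]

variable [HasFiniteBiproducts C] [Finite G]

theorem lift_shiftRetract_indIso (P : EquivariantObject A) {Y : C} (s : Retract Y P.X) (g : G) :
    biproduct.lift (fun h => (shiftRetract P s h).r) ≫ (indIso A Y g).hom =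
      (P.α g).hom ≫ (A.F g).map (biproduct.lift fun h => (shiftRetract P s h).r) := by
  apply hom_ext_map_sum
  intro l
  rw [Category.assoc, indIso_π, Category.assoc, ← Functor.map_comp, biproduct.lift_π,
    biproduct.lift_π_assoc]
  simp only [shiftRetract, Retract.trans_r, Retract.map_r, Iso.retract_r, Iso.symm_inv, P.α_mul,
    Functor.map_comp, Category.assoc, ← A.ε_naturality, Iso.hom_inv_id, Category.comp_id]

theorem comparison_essSurj [IsIdempotentComplete C] (hG : SplitsOver k G)
    (A : LinearAction k G C) : (comparison A).EssSurj where
  mem_essImage Q := by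
    cases nonempty_fintype G
    cases nonempty_fintype (G →* kˣ)
    have complete := completeOrthogonalIdempotents_character hG (characterHom Q)
    obtain ⟨Y, i, r, hir, hri⟩ := IsIdempotentComplete.idempotents_split Q.X.X
      (characterProjection Q 1) (complete.idem 1)
    let s := shiftRetract Q.X ⟨i, r, hir⟩
    have s_idem (g : G) : (s g).r ≫ (s g).i = characterProjection Q g := by
      rw [shiftRetract_r_comp_i, hri, reassoc_of% α_map_characterProjection, Iso.hom_inv_id,
        Category.comp_id]
    have s_character (χ : G →* kˣ) (g : G) :
        characterEnd Q χ ≫ (s g).r = (χ g : k) • (s g).r := by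
      have := congrArg (· ≫ (s g).r) (characterEnd_characterProjection Q χ g)
      simpa only [← s_idem, Linear.smul_comp, Category.assoc, Retract.retract,
        Category.comp_id] using this
    let E : Q.X ≅ indObj A Y := EquivariantObject.mkIso (Q := indObj A Y)
      (biproductIsoOfRetracts s complete s_idem) (lift_shiftRetract_indIso Q.X _)
    refine ⟨Y, ⟨(EquivariantObject.mkIso (Q := (comparison A).obj Y) E fun χ => ?_).symm⟩⟩
    ext1
    change biproduct.lift (fun g => (s g).r) ≫ characterScale A Y χ =
      characterEnd Q χ ≫ biproduct.lift fun g => (s g).r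
    apply biproduct.hom_ext
    intro g
    rw [Category.assoc, Category.assoc, characterScale_π, Linear.comp_smul, biproduct.lift_π,
      s_character]

theorem comparison_isEquivalence [IsIdempotentComplete C] (hG : SplitsOver k G)
    (A : LinearAction k G C) : (comparison A).IsEquivalence where
  full := comparison_full hG A
  essSurj := comparison_essSurj hG A

end Duality

section Shift

variable {k : Type*} [Field k] {G : Type*} [Group G]
  {C : Type*} [Category* C] [Preadditive C] [Linear k C]

theorem cocycle_inv (A : LinearAction k G C) (g h l : G) (X : C) :
    (A.ε (g * h) l X).inv ≫ (A.ε g h ((A.F l).obj X)).inv =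
      eqToHom (congrArg (fun a => (A.F a).obj X) (mul_assoc g h l)) ≫
        (A.ε g (h * l) X).inv ≫ (A.F g).map (A.ε h l X).inv := by
  rw [← cancel_epi (A.ε (g * h) l X).hom, ← cancel_epi (A.ε g h ((A.F l).obj X)).hom,
    reassoc_of% A.cocycle g h l X]
  simp [← Functor.map_comp]

variable [HasFiniteBiproducts C] [Finite G]

/-- The isomorphism `⨁_h F_h F_g X ≅ ⨁_h F_h X` with components `ε_{h,g} : F_h F_g X ≅ F_{hg} X`. -/
@[simps]
def rightShiftIso (A : LinearAction k G C) (g : G) (X : C) :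
    (⨁ fun h => (A.F h).obj ((A.F g).obj X)) ≅ ⨁ fun h => (A.F h).obj X where
  hom := biproduct.desc fun h => (A.ε h g X).hom ≫ biproduct.ι (fun h => (A.F h).obj X) (h * g)
  inv := biproduct.lift fun h => biproduct.π (fun h => (A.F h).obj X) (h * g) ≫ (A.ε h g X).inv
  hom_inv_id := by
    apply biproduct.hom_ext'
    intro i
    apply biproduct.hom_ext
    intro j
    simp only [biproduct.ι_desc_assoc, Category.assoc, biproduct.lift_π, Category.comp_id]
    obtain rfl | hij := eq_or_ne i j
    · simp
    · rw [biproduct.ι_π_ne_assoc _ (mul_left_injective g |>.ne hij), biproduct.ι_π_ne _ hij]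
      simp
  inv_hom_id := by
    cases nonempty_fintype G
    simp only [lift_desc', Category.assoc, Iso.inv_hom_id_assoc]
    rw [← total']
    exact Equiv.sum_comp (Equiv.mulRight g) fun h => biproduct.π _ h ≫ biproduct.ι _ h

/-- The isomorphism `Ind X ≅ Ind F_g X`. -/
def indShiftIso (A : LinearAction k G C) (g : G) (X : C) :
    indObj A X ≅ indObj A ((A.F g).obj X) :=
  EquivariantObject.mkIso (rightShiftIso A g X).symm fun a => by
    apply hom_ext_map_sum
    intro l
    rw [Category.assoc, indIso_π, Category.assoc, ← Functor.map_comp, Iso.symm_hom,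
      rightShiftIso_inv, biproduct.lift_π, biproduct.lift_π_assoc, Category.assoc,
      Functor.map_comp, reassoc_of% indIso_π, cocycle_inv,
      reassoc_of% biproduct.π_comp_eqToHom (fun h => (A.F h).obj X) (mul_assoc a l g)]

theorem rightShiftIso_inv_characterScale (A : LinearAction k G C) (g : G) (X : C) (χ : G →* kˣ) :
    (rightShiftIso A g X).inv ≫ characterScale A ((A.F g).obj X) χ =
      ((χ⁻¹ g : kˣ) : k) • characterScale A X χ ≫ (rightShiftIso A g X).inv := by
  apply biproduct.hom_ext
  intro h
  rw [Linear.smul_comp, Category.assoc, Category.assoc, characterScale_π, Linear.comp_smul,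
    rightShiftIso_inv, biproduct.lift_π, reassoc_of% characterScale_π, Linear.smul_comp]
  simp [smul_smul, mul_comm]

/-- The comparison functor intertwines `F_g` and the twist by `g`. -/
def comparisonShiftIso (A : LinearAction k G C) (g : G) (X : C) :
    (comparison A).obj ((A.F g).obj X) ≅ ((bidualAction A).F g).obj ((comparison A).obj X) :=
  (EquivariantObject.mkIso (P := ((bidualAction A).F g).obj ((comparison A).obj X))
    (Q := (comparison A).obj ((A.F g).obj X)) (indShiftIso A g X) fun χ =>
    EquivariantObject.hom_ext <| (rightShiftIso_inv_characterScale A g X χ).trans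
      (Linear.smul_comp _ _ _ _ _ _).symm).symm

end Shift

section EquivariantFunctor

variable {k : Type*} [Field k] {G : Type*} [Group G]
  {C : Type*} [Category* C] [Preadditive C] [Linear k C]
  {D : Type*} [Category* D] [Preadditive D] [Linear k D]
  {E : Type*} [Category* E] [Preadditive E] [Linear k E]
  {A : LinearAction k G C} {B : LinearAction k G D} {B' : LinearAction k G E}

/-- A functor `F` between categories with `G`-action, with coherent natural isomorphisms
`δ_g : F F_g ≅ F_g F`. -/
structure EquivariantFunctor (A : LinearAction k G C) (B : LinearAction k G D) where
  F : C ⥤ D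
  δ : ∀ (g : G) (X : C), F.obj ((A.F g).obj X) ≅ (B.F g).obj (F.obj X)
  δ_naturality : ∀ (g : G) {X Y : C} (f : X ⟶ Y),
    F.map ((A.F g).map f) ≫ (δ g Y).hom = (δ g X).hom ≫ (B.F g).map (F.map f)
  δ_mul : ∀ (g h : G) (X : C),
    F.map (A.ε g h X).hom ≫ (δ (g * h) X).hom =
      (δ g ((A.F h).obj X)).hom ≫ (B.F g).map (δ h X).hom ≫ (B.ε g h (F.obj X)).hom

/-- The equivariant functor underlying an equivariant autoequivalence. -/
def EquivariantAutoequiv.toEquivariantFunctor (P : EquivariantAutoequiv A) :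
    EquivariantFunctor A A where
  F := P.F
  δ := P.δ
  δ_naturality := P.δ_naturality
  δ_mul := P.δ_mul

instance (P : EquivariantAutoequiv A) : P.toEquivariantFunctor.F.Additive := P.additive

instance (P : EquivariantAutoequiv A) : P.toEquivariantFunctor.F.Linear k := P.linear

instance (P : EquivariantAutoequiv A) : P.toEquivariantFunctor.F.IsEquivalence := P.isEquivalence

namespace EquivariantFunctor

/-- The composite of equivariant functors. -/
def comp (Q : EquivariantFunctor A B) (P : EquivariantFunctor B B') : EquivariantFunctor A B' where
  F := Q.F ⋙ P.F
  δ g X := P.F.mapIso (Q.δ g X) ≪≫ P.δ g (Q.F.obj X)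
  δ_naturality g X Y f := by
    simp only [Functor.comp_map, Iso.trans_hom, Functor.mapIso_hom, Category.assoc]
    rw [← Functor.map_comp_assoc, Q.δ_naturality, Functor.map_comp_assoc, P.δ_naturality]
  δ_mul g h X := by
    simp only [Functor.comp_obj, Functor.comp_map, Iso.trans_hom, Functor.mapIso_hom,
      Functor.map_comp, Category.assoc]
    rw [← Functor.map_comp_assoc, Q.δ_mul]
    simp only [Functor.map_comp, Category.assoc]
    rw [P.δ_mul, reassoc_of% P.δ_naturality g (Q.δ h X).hom]

section Descent

variable (K : EquivariantFunctor B B') [K.F.Faithful] (Q : EquivariantFunctor A B') (F : C ⥤ D)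
  (e : F ⋙ K.F ≅ Q.F)

variable {K Q F} in
theorem hom_ext_descend {g : G} {X : C} {Z : D} {a b : Z ⟶ (B.F g).obj (F.obj X)}
    (h : K.F.map a ≫ (K.δ g (F.obj X)).hom ≫ (B'.F g).map (e.hom.app X) =
      K.F.map b ≫ (K.δ g (F.obj X)).hom ≫ (B'.F g).map (e.hom.app X)) : a = b :=
  K.F.map_injective <| by rwa [cancel_mono] at h

variable [K.F.Full]

/-- The isomorphisms `F F_g X ≅ F_g F X` obtained from those of `Q ≅ K F`. -/
def descendδ (g : G) (X : C) : F.obj ((A.F g).obj X) ≅ (B.F g).obj (F.obj X) :=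
  K.F.preimageIso (e.app ((A.F g).obj X) ≪≫ Q.δ g X ≪≫ (B'.F g).mapIso (e.app X).symm ≪≫
    (K.δ g (F.obj X)).symm)

theorem map_descendδ (g : G) (X : C) :
    K.F.map (descendδ K Q F e g X).hom ≫ (K.δ g (F.obj X)).hom ≫ (B'.F g).map (e.hom.app X) =
      e.hom.app ((A.F g).obj X) ≫ (Q.δ g X).hom := by
  simp [descendδ, ← Functor.map_comp]

/-- The equivariant structure on `F` descended along a fully faithful equivariant functor `K` from
that of `Q ≅ K F`. -/
def descend : EquivariantFunctor A B where
  F := F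
  δ := descendδ K Q F e
  δ_naturality g X Y f := by
    have nat {X Y : C} (f : X ⟶ Y) : K.F.map (F.map f) ≫ e.hom.app Y = e.hom.app X ≫ Q.F.map f :=
      e.hom.naturality f
    apply hom_ext_descend e
    rw [Functor.map_comp_assoc, map_descendδ, Functor.map_comp_assoc, reassoc_of% nat,
      Q.δ_naturality, reassoc_of% K.δ_naturality g (F.map f), ← Functor.map_comp, nat,
      Functor.map_comp, reassoc_of% map_descendδ K Q F e g X]
  δ_mul g h X := by
    have nat {X Y : C} (f : X ⟶ Y) : K.F.map (F.map f) ≫ e.hom.app Y = e.hom.app X ≫ Q.F.map f :=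
      e.hom.naturality f
    apply hom_ext_descend e
    rw [Functor.map_comp_assoc, map_descendδ, reassoc_of% nat, Q.δ_mul, Functor.map_comp_assoc,
      Functor.map_comp_assoc, reassoc_of% K.δ_mul g h (F.obj X), ← B'.ε_naturality,
      reassoc_of% K.δ_naturality g (descendδ K Q F e h X).hom, ← Functor.map_comp_assoc,
      ← Functor.map_comp_assoc, Category.assoc, map_descendδ, Functor.map_comp_assoc,
      reassoc_of% map_descendδ K Q F e g]

end Descent

end EquivariantFunctor

end EquivariantFunctor

section Lift

variable {k : Type*} [Field k] {G : Type*} [Group G]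
  {C : Type*} [Category* C] [Preadditive C] [Linear k C]
  {D : Type*} [Category* D] [Preadditive D] [Linear k D]
  {A : LinearAction k G C} {B : LinearAction k G D}

/-- The functor `(X, α) ↦ (F X, δ ∘ F(α))` induced on equivariant objects by an equivariant
functor `(F, δ)`. -/
def liftFunctor (P : EquivariantFunctor A B) : EquivariantObject A ⥤ EquivariantObject B where
  obj Q :=
    { X := P.F.obj Q.X
      α g := P.F.mapIso (Q.α g) ≪≫ P.δ g Q.X
      α_mul g h := by
        simp only [Iso.trans_hom, Functor.mapIso_hom, Q.α_mul, Functor.map_comp, Category.assoc]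
        rw [P.δ_mul, reassoc_of% P.δ_naturality g (Q.α h).hom] }
  map a :=
    { f := P.F.map a.f
      comm g := by
        simp only [Iso.trans_hom, Functor.mapIso_hom, Category.assoc]
        rw [← P.δ_naturality, ← Functor.map_comp_assoc, a.comm, Functor.map_comp_assoc] }
  map_id Q := EquivariantObject.hom_ext (P.F.map_id Q.X)
  map_comp a b := EquivariantObject.hom_ext (P.F.map_comp a.f b.f)

instance (P : EquivariantFunctor A B) [P.F.Additive] : (liftFunctor P).Additive where
  map_add := EquivariantObject.hom_ext P.F.map_add

instance (P : EquivariantFunctor A B) [P.F.Linear k] : (liftFunctor P).Linear k where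
  map_smul a r := EquivariantObject.hom_ext (P.F.map_smul r a.f)

instance (P : EquivariantFunctor A B) [P.F.Faithful] : (liftFunctor P).Faithful where
  map_injective h :=
    EquivariantObject.hom_ext (P.F.map_injective (congrArg EquivariantObject.Hom.f h))

instance (P : EquivariantFunctor A B) [P.F.Full] [P.F.Faithful] : (liftFunctor P).Full where
  map_surjective {Q R} b := by
    let f := P.F.preimage (X := Q.X) (Y := R.X) b.f
    have map_f : P.F.map f = b.f := P.F.map_preimage b.f
    have b_comm (g : G) : b.f ≫ P.F.map (R.α g).hom ≫ (P.δ g R.X).hom =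
        (P.F.map (Q.α g).hom ≫ (P.δ g Q.X).hom) ≫ (B.F g).map b.f := b.comm g
    refine ⟨⟨f, fun g => P.F.map_injective ?_⟩, EquivariantObject.hom_ext map_f⟩
    rw [← cancel_mono (P.δ g R.X).hom, Functor.map_comp_assoc, Functor.map_comp_assoc,
      P.δ_naturality, ← Category.assoc (P.F.map (Q.α g).hom), map_f]
    exact b_comm g

section Descent

variable (P : EquivariantFunctor A B) [P.F.Full] [P.F.Faithful] {X : C} (Q : EquivariantObject B)
  (e : P.F.obj X ≅ Q.X)

/-- The isomorphisms `X ≅ F_g X` obtained from those of `Q ≅ P X`. -/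
def descendα (g : G) : X ≅ (A.F g).obj X :=
  P.F.preimageIso (e ≪≫ Q.α g ≪≫ (B.F g).mapIso e.symm ≪≫ (P.δ g X).symm)

theorem map_descendα (g : G) :
    P.F.map (descendα P Q e g).hom ≫ (P.δ g X).hom ≫ (B.F g).map e.hom =
      e.hom ≫ (Q.α g).hom := by
  simp [descendα, ← Functor.map_comp]

/-- The equivariant structure on `X` descended along a fully faithful equivariant functor `P` from
that of `Q ≅ P X`. -/
def EquivariantObject.descend : EquivariantObject A where
  X := X
  α := descendα P Q e
  α_mul g h := by
    apply P.F.map_injective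
    rw [← cancel_mono ((P.δ (g * h) X).hom ≫ (B.F (g * h)).map e.hom), map_descendα, Q.α_mul,
      Functor.map_comp_assoc, Functor.map_comp_assoc, reassoc_of% P.δ_mul g h X,
      ← B.ε_naturality, reassoc_of% P.δ_naturality g (descendα P Q e h).hom,
      ← Functor.map_comp_assoc, ← Functor.map_comp_assoc, Category.assoc, map_descendα,
      Functor.map_comp_assoc, reassoc_of% map_descendα P Q e g]

end Descent

instance (P : EquivariantFunctor A B) [P.F.IsEquivalence] : (liftFunctor P).IsEquivalence where
  essSurj := ⟨fun Q =>
    let e := P.F.objObjPreimageIso Q.X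
    ⟨.descend P Q e, ⟨EquivariantObject.mkIso (P := (liftFunctor P).obj (.descend P Q e)) e
      fun g => (map_descendα P Q e g).symm.trans (Category.assoc _ _ _).symm⟩⟩⟩

/-- The functor induced on equivariant objects commutes with twists. -/
def liftTwistIso (P : EquivariantFunctor A B) [P.F.Linear k] (χ : G →* kˣ)
    (Q : EquivariantObject A) :
    (liftFunctor P).obj ((twist A χ).obj Q) ≅ (twist B χ).obj ((liftFunctor P).obj Q) :=
  EquivariantObject.mkIso (P := (liftFunctor P).obj ((twist A χ).obj Q))
    (Q := (twist B χ).obj ((liftFunctor P).obj Q)) (Iso.refl (P.F.obj Q.X)) fun g => by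
      simp [liftFunctor, twist]

/-- The functor induced on equivariant objects, as an equivariant functor for any group acting by
twists. -/
def liftEquivariantFunctor (P : EquivariantFunctor A B) [P.F.Linear k] {K : Type*} [Group K]
    (φ : K →* G →* kˣ) : EquivariantFunctor (twistAction A φ) (twistAction B φ) where
  F := liftFunctor P
  δ x := liftTwistIso P (φ x)
  δ_naturality x X Y f := EquivariantObject.hom_ext <|
    (Category.comp_id (P.F.map f.f)).trans (Category.id_comp (P.F.map f.f)).symm
  δ_mul x y X := by
    ext1
    change P.F.map (𝟙 X.X) ≫ 𝟙 (P.F.obj X.X) = 𝟙 (P.F.obj X.X) ≫ 𝟙 (P.F.obj X.X) ≫ 𝟙 (P.F.obj X.X)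
    simp

/-- An equivariant autoequivalence of `C` induces one of the category of equivariant objects with
the dual action. -/
def liftAutoequiv (P : EquivariantAutoequiv A) : EquivariantAutoequiv (dualAction A) :=
  let L := liftEquivariantFunctor P.toEquivariantFunctor (MonoidHom.id (G →* kˣ))
  { F := liftFunctor P.toEquivariantFunctor
    additive := inferInstance
    linear := inferInstance
    isEquivalence := inferInstance
    δ := L.δ
    δ_naturality := L.δ_naturality
    δ_mul := L.δ_mul }

theorem δ_comp_ε_inv (P : EquivariantFunctor A B) (g h : G) (X : C) :
    (P.δ (g * h) X).hom ≫ (B.ε g h (P.F.obj X)).inv =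
      P.F.map (A.ε g h X).inv ≫ (P.δ g ((A.F h).obj X)).hom ≫ (B.F g).map (P.δ h X).hom := by
  rw [Iso.comp_inv_eq, Category.assoc, Category.assoc, ← P.δ_mul, ← Functor.map_comp_assoc,
    Iso.inv_hom_id, CategoryTheory.Functor.map_id, Category.id_comp]

variable [HasFiniteBiproducts C] [HasFiniteBiproducts D] [Finite G]

/-- The isomorphism `F (⨁_h F_h X) ≅ ⨁_h F_h F X`. -/
def mapIndIso (P : EquivariantFunctor A B) [P.F.Additive] (X : C) :
    P.F.obj (⨁ fun h => (A.F h).obj X) ≅ ⨁ fun h => (B.F h).obj (P.F.obj X) :=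
  mapSumIso P.F (fun h => (A.F h).obj X) ≪≫ biproduct.mapIso fun h => P.δ h X

theorem mapIndIso_hom_π (P : EquivariantFunctor A B) [P.F.Additive] (X : C) (l : G) :
    (mapIndIso P X).hom ≫ biproduct.π (fun h => (B.F h).obj (P.F.obj X)) l =
      P.F.map (biproduct.π (fun h => (A.F h).obj X) l) ≫ (P.δ l X).hom := by
  simp [mapIndIso]

theorem mapIndIso_hom_comm (P : EquivariantFunctor A B) [P.F.Additive] (X : C) (g : G) :
    (mapIndIso P X).hom ≫ (indIso B (P.F.obj X) g).hom =
      (P.F.map (indIso A X g).hom ≫ (P.δ g (⨁ fun h => (A.F h).obj X)).hom) ≫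
        (B.F g).map (mapIndIso P X).hom := by
  apply hom_ext_map_sum
  intro l
  rw [Category.assoc, indIso_π, reassoc_of% mapIndIso_hom_π, δ_comp_ε_inv,
    Category.assoc, Category.assoc, ← Functor.map_comp, mapIndIso_hom_π, Functor.map_comp,
    ← reassoc_of% P.δ_naturality, ← Functor.map_comp_assoc, ← Functor.map_comp_assoc, indIso_π]

/-- The isomorphism `F (Ind X) ≅ Ind (F X)` of equivariant objects. -/
def indLiftIso (P : EquivariantFunctor A B) [P.F.Additive] (X : C) :
    (liftFunctor P).obj (indObj A X) ≅ indObj B (P.F.obj X) :=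
  EquivariantObject.mkIso (P := (liftFunctor P).obj (indObj A X)) (Q := indObj B (P.F.obj X))
    (mapIndIso P X) (mapIndIso_hom_comm P X)

end Lift

section EquivariantComparison

variable {k : Type*} [Field k] {G : Type*} [Group G] [Finite G]
  {C : Type*} [Category* C] [Preadditive C] [Linear k C] [HasFiniteBiproducts C]

theorem rightShiftIso_naturality (A : LinearAction k G C) (g : G) {X Y : C} (f : X ⟶ Y) :
    (biproduct.map fun h => (A.F h).map ((A.F g).map f)) ≫ (rightShiftIso A g Y).hom =
      (rightShiftIso A g X).hom ≫ biproduct.map fun h => (A.F h).map f := by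
  apply biproduct.hom_ext'
  intro h
  rw [biproduct.ι_map_assoc, rightShiftIso_hom, rightShiftIso_hom, biproduct.ι_desc,
    biproduct.ι_desc_assoc, Category.assoc, biproduct.ι_map, reassoc_of% A.ε_naturality]

theorem rightShiftIso_mul (A : LinearAction k G C) (g h : G) (X : C) :
    (biproduct.map fun l => (A.F l).map (A.ε g h X).hom) ≫ (rightShiftIso A (g * h) X).hom =
      (rightShiftIso A g ((A.F h).obj X)).hom ≫ (rightShiftIso A h X).hom := by
  apply biproduct.hom_ext'
  intro l
  rw [biproduct.ι_map_assoc, rightShiftIso_hom, rightShiftIso_hom, rightShiftIso_hom,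
    biproduct.ι_desc, biproduct.ι_desc_assoc, Category.assoc, biproduct.ι_desc,
    ← reassoc_of% A.cocycle l g h X, biproduct.eqToHom_comp_ι (fun h => (A.F h).obj X)
      (mul_assoc l g h)]

/-- The comparison functor as an equivariant functor. -/
def comparisonEquivariant (A : LinearAction k G C) : EquivariantFunctor A (bidualAction A) where
  F := comparison A
  δ := comparisonShiftIso A
  δ_naturality g _ _ f :=
    EquivariantObject.hom_ext (EquivariantObject.hom_ext (rightShiftIso_naturality A g f))
  δ_mul g h X := EquivariantObject.hom_ext <| EquivariantObject.hom_ext <|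
    (rightShiftIso_mul A g h X).trans <|
      congrArg ((rightShiftIso A g ((A.F h).obj X)).hom ≫ ·) (Category.comp_id _).symm

end EquivariantComparison

section Correspondence

variable {k : Type*} [Field k] {G : Type*} [Group G]
  {C : Type*} [Category* C] [Preadditive C] [Linear k C] {A : LinearAction k G C}

/-- The functor forgetting the equivariant structure. -/
def forget (A : LinearAction k G C) : EquivariantObject A ⥤ C where
  obj P := P.X
  map a := a.f

instance (A : LinearAction k G C) : (forget A).Additive where
  map_add := rfl

variable [HasFiniteBiproducts C]

theorem orbitRel_mk_iff {M M' : BasicStable A} :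
    MulAction.orbitRel (EquivariantAut A) (Stab A) (Quotient.mk _ M) (Quotient.mk _ M') ↔
      ∃ P : EquivariantAutoequiv A, BasicStable.map P M' ≈ M := by
  constructor
  · rintro ⟨⟨P⟩, hP⟩
    exact ⟨P, Quotient.exact hP⟩
  · rintro ⟨P, hP⟩
    exact ⟨Quotient.mk _ P, Quotient.sound hP⟩

section KrullSchmidt

variable [IsIdempotentComplete C]

theorem isStable_of_addClosure_eq
    (homFinite : ∀ X Y : C, Module.Finite k (X ⟶ Y)) {M T : C} (hM : IsBasic M)
    (hT : IsStable A T) (h : addClosure M = addClosure T) : IsStable A M := fun g =>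
  nonempty_iso_of_addClosure_eq homFinite (isBasic_map (A.F g) hM) hM <| calc
    addClosure ((A.F g).obj M) = addClosure ((A.F g).obj T) := addClosure_map_eq (A.F g) h
    _ = addClosure T := addClosure_eq_of_iso (hT g).some
    _ = addClosure M := h.symm

theorem exists_basicStable_addClosure_eq (homFinite : ∀ X Y : C, Module.Finite k (X ⟶ Y)) {X : C}
    (hX : IsStable A X) : ∃ M : BasicStable A, addClosure M.1 = addClosure X := by
  obtain ⟨M, hM, h⟩ := exists_isBasic_addClosure_eq homFinite X
  exact ⟨⟨M, hM, isStable_of_addClosure_eq homFinite hM hX h⟩, h⟩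

theorem BasicStable.equiv_iff (homFinite : ∀ X Y : C, Module.Finite k (X ⟶ Y))
    {M M' : BasicStable A} : M ≈ M' ↔ addClosure M.1 = addClosure M'.1 :=
  ⟨fun ⟨e⟩ => addClosure_eq_of_iso e, nonempty_iso_of_addClosure_eq homFinite M.2.1 M'.2.1⟩

end KrullSchmidt

variable [Finite G]

theorem addClosure_sum_of_isStable {M : C} (hM : IsStable A M) :
    addClosure (⨁ fun g => (A.F g).obj M) = addClosure M :=
  addClosure_eq
    (addClosure_biproduct _ fun g => addClosure_of_iso (hM g).some)
    (addClosure_trans (addClosure_of_iso (hM 1).some.symm)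
      (addClosure_component (fun g => (A.F g).obj M) 1))

theorem isStable_sum (A : LinearAction k G C) (X : C) : IsStable A (⨁ fun g => (A.F g).obj X) :=
  fun g => ⟨(indIso A X g).symm⟩

theorem isStable_indObj (A : LinearAction k G C) (X : C) :
    IsStable (dualAction A) (indObj A X) :=
  fun χ => ⟨(indTwistIso A X χ).symm⟩

theorem addClosure_ind_sum (A : LinearAction k G C) (X : C) :
    addClosure ((inductionFunctor A).obj (⨁ fun g => (A.F g).obj X)) =
      addClosure ((inductionFunctor A).obj X) :=
  addClosure_eq
    (addClosure_trans (addClosure_of_iso (mapSumIso (inductionFunctor A) _))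
      (addClosure_biproduct _ fun g => addClosure_of_iso (indShiftIso A g X).symm))
    (addClosure_trans (addClosure_of_iso (indShiftIso A 1 X))
      (addClosure_map (inductionFunctor A) (addClosure_component (fun g => (A.F g).obj X) 1)))

theorem addClosure_liftAutoequiv (P : EquivariantAutoequiv A) {M : C} {N : EquivariantObject A}
    (h : addClosure N = addClosure ((inductionFunctor A).obj M)) :
    addClosure ((liftAutoequiv P).F.obj N) = addClosure ((inductionFunctor A).obj (P.F.obj M)) :=
  (addClosure_map_eq (liftFunctor P.toEquivariantFunctor) h).trans
    (addClosure_eq_of_iso (indLiftIso P.toEquivariantFunctor M))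

variable [IsIdempotentComplete C]

theorem BasicStable.equiv_iff_ind (homFinite : ∀ X Y : C, Module.Finite k (X ⟶ Y))
    {M M' : BasicStable A} :
    M ≈ M' ↔
      addClosure ((inductionFunctor A).obj M.1) = addClosure ((inductionFunctor A).obj M'.1) := by
  refine ⟨fun ⟨e⟩ => addClosure_eq_of_iso ((inductionFunctor A).mapIso e), fun h => ?_⟩
  rw [equiv_iff homFinite, ← addClosure_sum_of_isStable M.2.2, ← addClosure_sum_of_isStable M'.2.2]
  exact addClosure_map_eq (forget A) h

theorem exists_basicStable_dualAction (homFinite : ∀ X Y : C, Module.Finite k (X ⟶ Y))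
    (M : BasicStable A) : ∃ N : BasicStable (dualAction A),
      addClosure N.1 = addClosure ((inductionFunctor A).obj M.1) :=
  exists_basicStable_addClosure_eq (homFinite_equivariant homFinite A) (isStable_indObj A M.1)

end Correspondence

section DualCorrespondence

variable {k : Type*} [Field k] {G : Type*} [Group G] [Finite G]
  {C : Type*} [Category* C] [Preadditive C] [Linear k C] [HasFiniteBiproducts C]
  [IsIdempotentComplete C] {A : LinearAction k G C}

theorem exists_basicStable_of_dualAction (homFinite : ∀ X Y : C, Module.Finite k (X ⟶ Y))
    (hG : SplitsOver k G) (N : BasicStable (dualAction A)) :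
    ∃ M : BasicStable A, addClosure N.1 = addClosure ((inductionFunctor A).obj M.1) := by
  have := comparison_isEquivalence hG A
  let Y := (comparison A).objPreimage (indObj (dualAction A) N.1)
  let e : (inductionFunctor A).obj Y ≅ ⨁ fun χ => ((dualAction A).F χ).obj N.1 :=
    (forget (dualAction A)).mapIso ((comparison A).objObjPreimageIso (indObj (dualAction A) N.1))
  obtain ⟨M, hM⟩ := exists_basicStable_addClosure_eq homFinite (isStable_sum A Y)
  use M
  calc addClosure N.1
    _ = addClosure (⨁ fun χ => ((dualAction A).F χ).obj N.1) :=
      (addClosure_sum_of_isStable N.2.2).symm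
    _ = addClosure ((inductionFunctor A).obj Y) := (addClosure_eq_of_iso e).symm
    _ = addClosure ((inductionFunctor A).obj (⨁ fun g => (A.F g).obj Y)) :=
      (addClosure_ind_sum A Y).symm
    _ = addClosure ((inductionFunctor A).obj M.1) :=
      (addClosure_map_eq (inductionFunctor A) hM).symm

theorem exists_ind_iso_of_dualAction (hG : SplitsOver k G)
    (E : EquivariantAutoequiv (dualAction A)) : ∃ P : EquivariantAutoequiv A, ∀ X, Nonempty
      ((inductionFunctor A).obj (P.F.obj X) ≅ E.F.obj ((inductionFunctor A).obj X)) := by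
  have := comparison_isEquivalence hG A
  let W := (comparison A).asEquivalence
  have : W.functor.Additive := inferInstanceAs (comparison A).Additive
  have : W.functor.Linear k := inferInstanceAs ((comparison A).Linear k)
  let K := comparisonEquivariant A
  have : K.F.IsEquivalence := inferInstanceAs (comparison A).IsEquivalence
  let T := liftFunctor E.toEquivariantFunctor
  let Q := K.comp (liftEquivariantFunctor E.toEquivariantFunctor MonoidHom.eval)
  let F : C ⥤ C := (W.functor ⋙ T) ⋙ W.inverse
  let e : F ⋙ W.functor ≅ W.functor ⋙ T := Functor.isoWhiskerLeft (W.functor ⋙ T) W.counitIso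
  let R := EquivariantFunctor.descend K Q F e
  let P : EquivariantAutoequiv A :=
    { F := F
      additive := inferInstance
      linear := inferInstance
      isEquivalence := inferInstance
      δ := R.δ
      δ_naturality := R.δ_naturality
      δ_mul := R.δ_mul }
  exact ⟨P, fun X => ⟨(forget (dualAction A)).mapIso (e.app X)⟩⟩

theorem exists_equiv_stab (homFinite : ∀ X Y : C, Module.Finite k (X ⟶ Y)) (hG : SplitsOver k G)
    (A : LinearAction k G C) : ∃ ι : Stab A ≃ Stab (dualAction A),
      ∀ (M : BasicStable A) (N : BasicStable (dualAction A)),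
        ι (Quotient.mk _ M) = Quotient.mk _ N ↔
          addClosure N.1 = addClosure ((inductionFunctor A).obj M.1) := by
  have hf := homFinite_equivariant homFinite A
  choose f hfM using fun M : BasicStable A => exists_basicStable_dualAction homFinite M
  have f_iff (M M' : BasicStable A) : f M ≈ f M' ↔ M ≈ M' := by
    rw [BasicStable.equiv_iff hf, BasicStable.equiv_iff_ind homFinite, hfM, hfM]
  have f_equiv_iff (M : BasicStable A) (N : BasicStable (dualAction A)) :
      f M ≈ N ↔ addClosure N.1 = addClosure ((inductionFunctor A).obj M.1) := by
    rw [BasicStable.equiv_iff hf, hfM, eq_comm]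
  let φ : Stab A → Stab (dualAction A) := Quotient.map f fun M M' => (f_iff M M').2
  have φ_injective : Function.Injective φ := by
    rintro ⟨M⟩ ⟨M'⟩ h
    exact Quotient.sound ((f_iff M M').1 (Quotient.exact h))
  have φ_surjective : Function.Surjective φ := by
    rintro ⟨N⟩
    obtain ⟨M, hM⟩ := exists_basicStable_of_dualAction homFinite hG N
    exact ⟨Quotient.mk _ M, Quotient.sound ((f_equiv_iff M N).2 hM)⟩
  exact ⟨Equiv.ofBijective φ ⟨φ_injective, φ_surjective⟩,
    fun M N => Quotient.eq.trans (f_equiv_iff M N)⟩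

theorem exists_map_equiv_iff (homFinite : ∀ X Y : C, Module.Finite k (X ⟶ Y))
    (hG : SplitsOver k G) {M M' : BasicStable A} {N N' : BasicStable (dualAction A)}
    (h : addClosure N.1 = addClosure ((inductionFunctor A).obj M.1))
    (h' : addClosure N'.1 = addClosure ((inductionFunctor A).obj M'.1)) :
    (∃ P : EquivariantAutoequiv A, BasicStable.map P M' ≈ M) ↔
      ∃ E : EquivariantAutoequiv (dualAction A), BasicStable.map E N' ≈ N := by
  have equiv_iff (E : EquivariantAutoequiv (dualAction A)) (P : EquivariantAutoequiv A)
      (hEP : addClosure (E.F.obj N'.1) = addClosure ((inductionFunctor A).obj (P.F.obj M'.1))) :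
      BasicStable.map P M' ≈ M ↔ BasicStable.map E N' ≈ N := by
    rw [BasicStable.equiv_iff_ind homFinite,
      BasicStable.equiv_iff (homFinite_equivariant homFinite A), h]
    exact Eq.congr_left hEP.symm
  constructor
  · rintro ⟨P, hP⟩
    exact ⟨liftAutoequiv P, (equiv_iff _ P (addClosure_liftAutoequiv P h')).1 hP⟩
  · rintro ⟨E, hE⟩
    obtain ⟨P, hP⟩ := exists_ind_iso_of_dualAction hG E
    have := E.additive
    have hEP := (addClosure_map_eq E.F h').trans (addClosure_eq_of_iso (hP M'.1).some.symm)
    exact ⟨P, (equiv_iff E P hEP).2 hE⟩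

end DualCorrespondence

end Equivariantization

end

open Equivariantization in
theorem proposition5p8 {k : Type w} [Field k] {C : Type u} [Category.{v} C] [Preadditive C]
    [Linear k C] [HasFiniteBiproducts C] [IsIdempotentComplete C]
    (homFinite : ∀ X Y : C, Module.Finite k (X ⟶ Y))
    {G : Type w'} [CommGroup G] [Finite G] (hG : SplitsOver k G) (A : LinearAction k G C) :
    ∃ ι : Stab A ≃ Stab (dualAction A),
      (∀ (M : BasicStable A) (N : BasicStable (dualAction A)),
        ι (Quotient.mk _ M) = Quotient.mk _ N → addClosure N.1 = addClosure ((inductionFunctor A).obj M.1)) ∧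
      ∃ κ : MulAction.orbitRel.Quotient (EquivariantAut A) (Stab A) ≃
          MulAction.orbitRel.Quotient (EquivariantAut (dualAction A)) (Stab (dualAction A)),
        ∀ x : Stab A, κ (Quotient.mk _ x) = Quotient.mk _ (ι x) := by
  obtain ⟨ι, hι⟩ := exists_equiv_stab homFinite hG A
  refine ⟨ι, fun M N => (hι M N).1, Quotient.congr ι ?_, fun x => rfl⟩
  rintro ⟨M⟩ ⟨M'⟩
  obtain ⟨N, hN⟩ := Quotient.exists_rep (ι (Quotient.mk _ M))
  obtain ⟨N', hN'⟩ := Quotient.exists_rep (ι (Quotient.mk _ M'))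
  have orbit_iff := exists_map_equiv_iff homFinite hG ((hι M N).1 hN.symm) ((hι M' N').1 hN'.symm)
  rw [← orbitRel_mk_iff, ← orbitRel_mk_iff, hN, hN'] at orbit_iff
  exact orbit_iff
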